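/- **Setting.** Let $M$ be an integer $d\times d$ dilation matrix (all eigenvalues have modulus $>1$), $m=|\det M|$, $M^*=M^{T}$. Let $D=\{s_0=\mathbf 0,s_1,\dots,s_{m-1}\}\subset\mathbb Z^d$ and $D^*=\{s_0^*=\mathbf 0,\dots,s^*_{m-1}\}\subset\mathbb Z^d$ be sets of digits for $M$ and $M^*$, i.e. pairwise incongruent modulo $M\mathbb Z^d$, resp. $M^*\mathbb Z^d$. Let $V$ be the generalized Vilenkin group of all sequences $x=(x_j)_{j\in\mathbb Z}$, $x_j\in D$, having only finitely many nonzero $x_j$ with $j<0$, with coordinatewise addition $\oplus$ modulo $M$, the topology with the base $U_l=\{x: x_j=\mathbf 0\ \forall j\le l\}$, $l\in\mathbb Z$, of neighbourhoods of zero, and the Haar measure $\mu$ normalized by $\mu(U_0)=1$; put $U=U_0$, $(\mathcal Mx)_j=x_{j+1}$, $H=\{x\in V:x_j=\mathbf 0\ \forall j>0\}$. For $k\in\mathbb Z_+$ with base-$m$ expansion $k=\sum_{j\ge 0} k_jm^j$ let $\gamma_{[k]}\in H$ have the coordinates $(\gamma_{[k]})_{-j}=s_{k_j}$, $j\ge0$,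 and let $U_{l,k}=\mathcal M^{-l}\gamma_{[k]}\oplus\mathcal M^{-l}(U)$. Let $\mathcal S_l^{(k)}$ be the class of functions $V\to\mathbb C$ that vanish outside $\mathcal M^k(U)$ and are constant on each of the sets $U_{l,i}$, $i\in\mathbb Z_+$. Denote by $V^*,U_l^*,\mathcal M^*,\mu^*$ the same objects for $M^*,D^*$. For $x\in V$, $\omega\in V^*$ let $\chi(x,\omega)=\exp\bigl(2\pi i\sum_{j\in\mathbb Z}\langle M^{-1}x_j,\omega_{1-j}\rangle\bigr)$; the Fourier transform is $\widehat f(\omega)=\int_V f(x)\overline{\chi(x,\omega)}\,d\mu(x)$ for $f\in L_1(V)$, extended to $L_2(V)$ by $L_2$-limits. A Walsh polynomial of order $n$ is a linear combination of the functions $\chi(\gamma_{[k]},\cdot)$, $0\le k<m^n$, on $V^*$. A function $\varphi\in L_2(V)$ is refinable if $\varphi(x)=\sum_{k\ge 0}\alpha_k\varphi(\mathcal Mx\oplus\gamma_{[k]})$ a.e. for some numbers $\alpha_k$; it is orthogonal if moreover $\{\varphi(\cdot\oplus h): h\in H\}$ is orthonormal in $L_2(V)$. We write $\omega_{-N}\dots\omega_0\boldsymbol{,}\,\omega_1\dots\omega_l$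 for the element of $V^*$ with these coordinates and all others $\mathbf 0$. **Theorem.** Let $n,r\in\mathbb N$, $r\ge n\ge 2$, and let $\xi_0,\dots,\xi_r\in D^*\setminus\{\mathbf 0\}$ be such that $(\xi_k,\dots,\xi_{k+n-2})\ne(\xi_{k'},\dots,\xi_{k'+n-2})$ for all $0\le k<k'\le r-n+2$. Let $b:(D^*)^n\to\mathbb C$ satisfy: $b(\xi_k\dots\xi_{k+n-1})\in\{1,-1\}$ for $k=0,\dots,r-n+1$; $b(\mathbf 0\,\omega_2\dots\omega_n)\in\{1,-1\}$ whenever $(\omega_2,\dots,\omega_n)\neq(\xi_k,\dots,\xi_{k+n-2})$ for all $k=1,\dots,r-n+2$; $b(\mathbf 0\dots\mathbf 0)=1$; and $b=0$ at all other words. Put $m_0(\omega)=b(\omega_1\dots\omega_n)$, $\omega\in V^*$. Then $m_0$ is a Walsh polynomial of order $n$, and there is a unique $\varphi\in L_2(V)$ with $$\widehat\varphi=\prod_{j=1}^\infty m_0\bigl((\mathcal M^{*})^{-j}\,\cdot\,\bigr).$$ This $\varphi$ is refinable and orthogonal, $\varphi\in\mathcal S^{(n-1)}_{r-n+2}$ (after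 correction on a null set), and for every $\omega\in V^*$ $$\widehat\varphi(\omega)=\sum_{k=1}^{r-n+2}\mathbf 1_{\xi_0\dots\xi_{k-1}\boldsymbol{,}\,\xi_k\dots\xi_{k+n-2}\oplus U^*_{n-1}}(\omega)\prod_{j=1}^{k+n-1}b(\xi_{k-j}\dots\xi_{k+n-1-j})+\mathbf 1_{Q\oplus U^*_{n-1}}(\omega)\prod_{j=1}^{n-1}b(\mathbf 0\dots\mathbf 0\,\omega_1\dots\omega_{n-j}),$$ where $\xi_l=\mathbf 0$ for $l\le-1$ and $$Q=\{\mathbf 0\boldsymbol{,}\,\alpha_1\dots\alpha_{n-1}:\ \alpha_i\in D^*,\ (\alpha_1,\dots,\alpha_{n-1})\ne(\xi_k,\dots,\xi_{k+n-2})\ \ \forall k=1,\dots,r-n+2\}.$$ -/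

import Mathlib

open MeasureTheory Filter Topology
open scoped Pointwise ComplexConjugate ENNReal

namespace GenVilenkin

/-- A dilation matrix: an integer matrix all of whose complex eigenvalues have modulus `> 1`. -/
def IsDilation {d : ℕ} (M : Matrix (Fin d) (Fin d) ℤ) : Prop :=
  ∀ z ∈ spectrum ℂ (M.map (fun a : ℤ => (a : ℂ))), 1 < ‖z‖

/-- `l ≡ k (mod M)`. -/
def Congruent {d : ℕ} (M : Matrix (Fin d) (Fin d) ℤ) (l k : Fin d → ℤ) : Prop :=
  ∃ s : Fin d → ℤ, l - k = M.mulVec s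

/-- A set of digits `s_0 = 0, s_1, …, s_{m-1}` for `M`, where `m = |det M|`: `m` integer vectors
that are pairwise incongruent modulo `M`. (The presence of `s_0` forces `m ≠ 0`.) -/
structure DigitSet {d : ℕ} (M : Matrix (Fin d) (Fin d) ℤ) where
  /-- the digits `s_0, …, s_{m-1}` -/
  digit : Fin M.det.natAbs → (Fin d → ℤ)
  exists_zero : ∃ i : Fin M.det.natAbs, i.val = 0 ∧ digit i = 0
  incongruent : ∀ i j, i ≠ j → ¬ Congruent M (digit i) (digit j)

/-- The sublattice `M ℤ^d` of `ℤ^d`. -/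
abbrev lattice {d : ℕ} (M : Matrix (Fin d) (Fin d) ℤ) : Submodule ℤ (Fin d → ℤ) :=
  LinearMap.range M.mulVecLin

section Digits

variable {d : ℕ} {M : Matrix (Fin d) (Fin d) ℤ}

theorem DigitSet.m_pos (D : DigitSet M) : 0 < M.det.natAbs := by
  obtain ⟨i, -, -⟩ := D.exists_zero
  exact lt_of_le_of_lt (Nat.zero_le _) i.isLt

theorem DigitSet.det_ne_zero (D : DigitSet M) : M.det ≠ 0 :=
  Int.natAbs_pos.mp D.m_pos

theorem card_quotient (hM : M.det ≠ 0) :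
    Nat.card ((Fin d → ℤ) ⧸ lattice M) = M.det.natAbs := by
  have hinj : Function.Injective M.mulVecLin := by
    intro x y hxy
    exact Matrix.mulVec_injective_of_det_ne_zero hM hxy
  let e : (Fin d → ℤ) ≃ₗ[ℤ] lattice M := LinearEquiv.ofInjective M.mulVecLin hinj
  rw [← Submodule.natAbs_det_equiv (lattice M) e]
  have : (lattice M).subtype ∘ₗ AddMonoidHom.toIntLinearMap (e : (Fin d → ℤ) →+ lattice M)
      = Matrix.toLin' M := by
    ext x
    rfl
  rw [this, LinearMap.det_toLin']

/-- The digit set `D` as a type: the integer vectors `s_0, …, s_{m-1}`. -/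
def Digit (D : DigitSet M) : Type := {v : Fin d → ℤ // v ∈ Set.range D.digit}

/-- The residue class modulo `M` of a digit. -/
def Digit.toQuotient {D : DigitSet M} (v : Digit D) : (Fin d → ℤ) ⧸ lattice M :=
  Submodule.Quotient.mk v.1

theorem Digit.toQuotient_bijective (D : DigitSet M) :
    Function.Bijective (Digit.toQuotient (D := D)) := by
  have key : ∀ i j, (Submodule.Quotient.mk (D.digit i) : (Fin d → ℤ) ⧸ lattice M)
      = Submodule.Quotient.mk (D.digit j) → i = j := by
    intro i j h
    by_contra hij
    rw [Submodule.Quotient.eq] at h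
    obtain ⟨s, hs⟩ := h
    exact D.incongruent i j hij ⟨s, hs.symm⟩
  have hcard := card_quotient D.det_ne_zero
  have : Finite ((Fin d → ℤ) ⧸ lattice M) :=
    Nat.finite_of_card_ne_zero (by rw [hcard]; exact D.m_pos.ne')
  have hsurj : Function.Surjective
      (fun i => (Submodule.Quotient.mk (D.digit i) : (Fin d → ℤ) ⧸ lattice M)) := by
    have hb := (Nat.bijective_iff_injective_and_card
      (fun i => (Submodule.Quotient.mk (D.digit i) : (Fin d → ℤ) ⧸ lattice M))).2
      ⟨fun i j h => key i j h, by simp [hcard]⟩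
    exact hb.2
  constructor
  · rintro ⟨_, i, rfl⟩ ⟨_, j, rfl⟩ h
    have := key i j h
    subst this
    rfl
  · intro q
    obtain ⟨i, hi⟩ := hsurj q
    exact ⟨⟨D.digit i, i, rfl⟩, hi⟩

/-- Digits correspond bijectively to the residue classes modulo `M`. -/
noncomputable def Digit.equivQuotient (D : DigitSet M) : Digit D ≃ ((Fin d → ℤ) ⧸ lattice M) :=
  Equiv.ofBijective _ (Digit.toQuotient_bijective D)

/-- Addition of digits modulo `M`: the sum of two digits is the digit congruent to their sum. -/
noncomputable instance (D : DigitSet M) : AddCommGroup (Digit D) :=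
  (Digit.equivQuotient D).addCommGroup

theorem Digit.add_congruent {D : DigitSet M} (u v : Digit D) :
    Congruent M (u + v).1 (u.1 + v.1) := by
  have h : Digit.toQuotient (u + v) = Digit.toQuotient u + Digit.toQuotient v :=
    (Digit.equivQuotient D).apply_symm_apply _
  have h' : (Submodule.Quotient.mk (u + v).1 : (Fin d → ℤ) ⧸ lattice M)
      = Submodule.Quotient.mk (u.1 + v.1) := h
  rw [Submodule.Quotient.eq] at h'
  obtain ⟨s, hs⟩ := h'
  exact ⟨s, hs.symm⟩

theorem Digit.zero_val (D : DigitSet M) : (0 : Digit D).1 = 0 := by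
  obtain ⟨i, -, hi⟩ := D.exists_zero
  have h : (0 : Digit D) = ⟨D.digit i, i, rfl⟩ := by
    apply (Digit.equivQuotient D).injective
    have h1 : Digit.equivQuotient D (0 : Digit D) = 0 :=
      (Digit.equivQuotient D).apply_symm_apply _
    rw [h1]
    change (0 : (Fin d → ℤ) ⧸ lattice M) = Submodule.Quotient.mk (D.digit i)
    rw [hi]
    rfl
  rw [h]
  exact hi

instance (D : DigitSet M) : Finite (Digit D) :=
  Set.finite_range D.digit

/-- The digit `s_i` with `i = k mod m`. -/
def DigitSet.nthDigit (D : DigitSet M) (k : ℕ) : Digit D :=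
  ⟨D.digit ⟨k % M.det.natAbs, Nat.mod_lt _ D.m_pos⟩, _, rfl⟩

theorem DigitSet.nthDigit_zero (D : DigitSet M) : D.nthDigit 0 = 0 := by
  obtain ⟨i, hi0, hi⟩ := D.exists_zero
  apply Subtype.ext
  rw [Digit.zero_val, ← hi]
  change D.digit _ = D.digit i
  congr 1
  apply Fin.ext
  simp [hi0]

end Digits

section Group

variable {d : ℕ} {M : Matrix (Fin d) (Fin d) ℤ}

/-- The sequences of digits indexed by `ℤ` with only finitely many nonzero entries at negative
places, as a subgroup of all sequences under coordinatewise addition modulo `M`. -/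
def seqSubgroup (D : DigitSet M) : AddSubgroup (ℤ → Digit D) where
  carrier := {x | ∃ N : ℤ, ∀ j < N, x j = 0}
  zero_mem' := ⟨0, fun _ _ => rfl⟩
  add_mem' := by
    rintro x y ⟨N, hN⟩ ⟨K, hK⟩
    refine ⟨min N K, fun j hj => ?_⟩
    rw [Pi.add_apply, hN j (lt_of_lt_of_le hj (min_le_left _ _)),
      hK j (lt_of_lt_of_le hj (min_le_right _ _)), add_zero]
  neg_mem' := by
    rintro x ⟨N, hN⟩
    refine ⟨N, fun j hj => ?_⟩
    rw [Pi.neg_apply, hN j hj, neg_zero]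

/-- The generalized Vilenkin group `V` associated with the matrix `M` and the digit set `D`. -/
def Vilenkin (D : DigitSet M) : Type := seqSubgroup D

noncomputable instance (D : DigitSet M) : AddCommGroup (Vilenkin D) :=
  inferInstanceAs (AddCommGroup (seqSubgroup D))

instance (D : DigitSet M) : CoeFun (Vilenkin D) (fun _ => ℤ → Digit D) := ⟨fun x => x.1⟩

/-- The subgroups `U_l = {x : x_j = 0 for all j ≤ l}`. -/
def U (D : DigitSet M) (l : ℤ) : Set (Vilenkin D) := {x | ∀ j ≤ l, x j = 0}

/-- The topology for which the sets `U_l`, `l ∈ ℤ`, form a base of neighbourhoods of zero. -/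
instance (D : DigitSet M) : TopologicalSpace (Vilenkin D) where
  IsOpen S := ∀ x ∈ S, ∃ l : ℤ, ∀ u ∈ U D l, x + u ∈ S
  isOpen_univ := fun _ _ => ⟨0, fun _ _ => trivial⟩
  isOpen_inter := by
    rintro S T hS hT x ⟨hxS, hxT⟩
    obtain ⟨l, hl⟩ := hS x hxS
    obtain ⟨k, hk⟩ := hT x hxT
    exact ⟨max l k, fun u hu =>
      ⟨hl u fun j hj => hu j (hj.trans (le_max_left _ _)),
        hk u fun j hj => hu j (hj.trans (le_max_right _ _))⟩⟩
  isOpen_sUnion := by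
    rintro s hs x ⟨t, ht, hxt⟩
    obtain ⟨l, hl⟩ := hs t ht x hxt
    exact ⟨l, fun u hu => ⟨t, ht, hl u hu⟩⟩

theorem isOpen_iff {D : DigitSet M} {S : Set (Vilenkin D)} :
    IsOpen S ↔ ∀ x ∈ S, ∃ l : ℤ, ∀ u ∈ U D l, x + u ∈ S := Iff.rfl

theorem add_mem_U {D : DigitSet M} {l : ℤ} {u v : Vilenkin D} (hu : u ∈ U D l) (hv : v ∈ U D l) :
    u + v ∈ U D l := fun j hj => by
  change u j + v j = 0
  rw [hu j hj, hv j hj, add_zero]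

theorem neg_mem_U {D : DigitSet M} {l : ℤ} {u : Vilenkin D} (hu : u ∈ U D l) :
    -u ∈ U D l := fun j hj => by
  change -(u j) = 0
  rw [hu j hj, neg_zero]

theorem zero_mem_U (D : DigitSet M) (l : ℤ) : (0 : Vilenkin D) ∈ U D l := fun _ _ => rfl

theorem isOpen_coset {D : DigitSet M} (x : Vilenkin D) (l : ℤ) :
    IsOpen {y : Vilenkin D | y - x ∈ U D l} := by
  rw [isOpen_iff]
  intro y hy
  refine ⟨l, fun u hu => ?_⟩
  have : y + u - x = (y - x) + u := by abel
  change y + u - x ∈ U D l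
  rw [this]
  exact add_mem_U hy hu

theorem isOpen_U (D : DigitSet M) (l : ℤ) : IsOpen (U D l) := by
  simpa using isOpen_coset (0 : Vilenkin D) l

instance (D : DigitSet M) : IsTopologicalAddGroup (Vilenkin D) where
  continuous_add := by
    rw [continuous_def]
    intro S hS
    rw [isOpen_prod_iff]
    intro a b hab
    obtain ⟨l, hl⟩ := isOpen_iff.1 hS _ hab
    refine ⟨_, _, isOpen_coset a l, isOpen_coset b l, ?_, ?_, ?_⟩
    · simpa using zero_mem_U D l
    · simpa using zero_mem_U D l
    · rintro ⟨y, z⟩ ⟨hy, hz⟩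
      have := hl _ (add_mem_U hy hz)
      have e : a + b + (y - a + (z - b)) = y + z := by abel
      simp only [e] at this
      exact this
  continuous_neg := by
    rw [continuous_def]
    intro S hS
    rw [isOpen_iff]
    intro x hx
    obtain ⟨l, hl⟩ := isOpen_iff.1 hS _ hx
    refine ⟨l, fun u hu => ?_⟩
    have := hl _ (neg_mem_U hu)
    change -(x + u) ∈ S
    rwa [neg_add]

theorem isCompact_U_zero (D : DigitSet M) : IsCompact (U D 0) := by
  let _ : TopologicalSpace (Digit D) := ⊥
  have : DiscreteTopology (Digit D) := ⟨rfl⟩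
  let F : (ℕ → Digit D) → Vilenkin D := fun a =>
    ⟨fun j => if 0 < j then a j.toNat else 0, 0, fun j hj => if_neg (by omega)⟩
  have hF : Continuous F := by
    rw [continuous_def]
    intro S hS
    rw [isOpen_iff_mem_nhds]
    intro a ha
    obtain ⟨l, hl⟩ := isOpen_iff.1 hS _ ha
    have hopen : IsOpen (⋂ i ∈ Finset.range (l.toNat + 1),
        {c : ℕ → Digit D | c i = a i}) := by
      apply isOpen_biInter_finset
      intro i _
      exact (isOpen_discrete ({a i} : Set (Digit D))).preimage
        (continuous_apply (A := fun _ : ℕ => Digit D) i)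
    refine mem_of_superset (hopen.mem_nhds (by simp)) ?_
    intro c hc
    simp only [Set.mem_iInter, Set.mem_ofPred_eq, Finset.mem_range] at hc
    have hu : F c - F a ∈ U D l := by
      intro j hj
      change (if 0 < j then c j.toNat else 0) - (if 0 < j then a j.toNat else 0) = 0
      split_ifs with h
      · rw [hc j.toNat (by omega), sub_self]
      · rw [sub_self]
    have := hl _ hu
    rw [add_sub_cancel] at this
    exact this
  have hU : U D 0 = Set.range F := by
    ext x
    constructor
    · intro hx
      refine ⟨fun i => x i, ?_⟩
      apply Subtype.ext
      funext j
      change (if 0 < j then x ((j.toNat : ℕ) : ℤ) else 0) = x j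
      split_ifs with h
      · rw [Int.toNat_of_nonneg h.le]
      · exact (hx j (by omega)).symm
    · rintro ⟨a, rfl⟩ j hj
      exact if_neg (by omega)
  rw [hU]
  exact isCompact_range hF

instance (D : DigitSet M) : MeasurableSpace (Vilenkin D) := borel _

instance (D : DigitSet M) : BorelSpace (Vilenkin D) := ⟨rfl⟩

/-- `U = U_0` as a compact set with nonempty interior. -/
def compactU (D : DigitSet M) : TopologicalSpace.PositiveCompacts (Vilenkin D) where
  carrier := U D 0
  isCompact' := isCompact_U_zero D
  interior_nonempty' := by
    rw [(isOpen_U D 0).interior_eq]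
    exact ⟨0, zero_mem_U D 0⟩

/-- The Haar measure on `V`, normalized by `μ U = 1`. -/
noncomputable def haar (D : DigitSet M) : Measure (Vilenkin D) :=
  Measure.addHaarMeasure (compactU D)

theorem haar_U (D : DigitSet M) : haar D (U D 0) = 1 :=
  Measure.addHaarMeasure_self (K₀ := compactU D)

instance (D : DigitSet M) : (haar D).IsAddHaarMeasure :=
  inferInstanceAs ((Measure.addHaarMeasure (compactU D)).IsAddHaarMeasure)

/-- The power `𝓜^k`, `k ∈ ℤ`, of the shift `𝓜` with `(𝓜 x)_j = x_{j+1}`. -/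
def dil {D : DigitSet M} (k : ℤ) (x : Vilenkin D) : Vilenkin D :=
  ⟨fun j => x (j + k), by
    obtain ⟨N, hN⟩ := x.2
    exact ⟨N - k, fun j hj => hN (j + k) (by omega)⟩⟩

/-- `H = {x ∈ V : x_j = 0 for all j > 0}`. -/
def H (D : DigitSet M) : Set (Vilenkin D) := {x | ∀ j > 0, x j = 0}

/-- The element `γ_[k] ∈ H`: `(γ_[k])_{-j} = s_{k_j}` where `k = ∑_j k_j m^j` is the base-`m`
expansion of `k`. -/
noncomputable def gam (D : DigitSet M) (k : ℕ) : Vilenkin D :=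
  ⟨fun j => if 0 < j then 0 else D.nthDigit (k / M.det.natAbs ^ (-j).toNat), by
    refine ⟨-(k : ℤ), fun j hj => ?_⟩
    beta_reduce
    rw [if_neg (by omega)]
    rcases Nat.lt_or_ge 1 M.det.natAbs with h | h
    · have : k < M.det.natAbs ^ (-j).toNat :=
        lt_of_lt_of_le (by omega : k < (-j).toNat) (Nat.lt_pow_self h).le
      rw [Nat.div_eq_of_lt this]
      exact D.nthDigit_zero
    · have h1 : M.det.natAbs = 1 := le_antisymm h D.m_pos
      rw [← D.nthDigit_zero]
      apply Subtype.ext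
      change D.digit _ = D.digit _
      congr 1
      apply Fin.ext
      simp [h1, Nat.mod_one]⟩

/-- `U_{n,k} = 𝓜^{-n} γ_[k] ⊕ 𝓜^{-n}(U)`. -/
def Unk (D : DigitSet M) (n : ℤ) (k : ℕ) : Set (Vilenkin D) :=
  {dil (-n) (gam D k)} + dil (-n) '' U D 0

/-- The class `𝓢_n(V)` of functions that are constant on each `U_{n,k}`. -/
def StepFun (D : DigitSet M) (n : ℤ) : Set (Vilenkin D → ℂ) :=
  {f | ∀ k : ℕ, ∀ x ∈ Unk D n k, ∀ x' ∈ Unk D n k, f x = f x'}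

/-- The class `𝓢_n^{(k)}(V)` of the functions in `𝓢_n(V)` supported in `𝓜^k(U)`. -/
def TestFun (D : DigitSet M) (n k : ℤ) : Set (Vilenkin D → ℂ) :=
  {f | f ∈ StepFun D n ∧ Function.support f ⊆ dil k '' U D 0}

/-- The space `L_2(V)`. -/
noncomputable abbrev L2 (D : DigitSet M) := Lp ℂ 2 (haar D)

/-- The translate `φ(· ⊕ h)` of `φ ∈ L_2(V)`. -/
noncomputable def translate {D : DigitSet M} (φ : L2 D) (h : Vilenkin D) : L2 D :=
  Lp.compMeasurePreserving (fun x => x + h) (measurePreserving_add_right (haar D) h) φ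

/-- `φ ∈ L_2(V)` is refinable: `φ(x) = ∑_k α_k φ(𝓜 x ⊕ γ_[k])` for some numbers `α_k`
(for almost every `x`, the elements of `L_2(V)` being classes of functions). -/
def IsRefinable {D : DigitSet M} (φ : L2 D) : Prop :=
  ∃ α : ℕ → ℂ, ∀ᵐ x ∂(haar D), HasSum (fun k => α k * φ (dil 1 x + gam D k)) (φ x)

/-- An orthogonal refinable function: the translates `φ(· ⊕ h)`, `h ∈ H`, are orthonormal. -/
def IsOrthogonalRefinable {D : DigitSet M} (φ : L2 D) : Prop :=
  IsRefinable φ ∧ Orthonormal ℂ (fun h : H D => translate φ h.1)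

end Group

section Fourier

variable {d : ℕ} {M : Matrix (Fin d) (Fin d) ℤ}

/-- The number `⟨M⁻¹ x, w⟩` for integer vectors `x`, `w`. -/
noncomputable def pairing (M : Matrix (Fin d) (Fin d) ℤ) (x w : Fin d → ℤ) : ℝ :=
  ((M.map (fun a : ℤ => (a : ℝ)))⁻¹.mulVec fun i => (x i : ℝ)) ⬝ᵥ fun i => (w i : ℝ)

/-- `χ(x, ω) = exp (2πi ∑_{j ∈ ℤ} ⟨M⁻¹ x_j, ω_{1-j}⟩)`, `x ∈ V`, `ω ∈ V*`; the group `V*` is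
associated with `Mᵀ` and a digit set of `Mᵀ`. Only finitely many terms of the sum are nonzero. -/
noncomputable def chi {D : DigitSet M} {Ds : DigitSet M.transpose}
    (x : Vilenkin D) (ω : Vilenkin Ds) : ℂ :=
  Complex.exp (2 * Real.pi * Complex.I * ((∑ᶠ j : ℤ, pairing M (x j).1 (ω (1 - j)).1 : ℝ) : ℂ))

/-- The Fourier transform of an integrable function on `V`. -/
noncomputable def fourier {D : DigitSet M} (Ds : DigitSet M.transpose) (f : Vilenkin D → ℂ)
    (ω : Vilenkin Ds) : ℂ :=
  ∫ x, f x * conj (chi x ω) ∂(haar D)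

/-- `g` is (a representative of) the Fourier transform of `f ∈ L_2(V)`: the extension of the
Fourier transform from `L_1 ∩ L_2` to `L_2` by `L_2`-limits. -/
def IsFourierL2 {D : DigitSet M} {Ds : DigitSet M.transpose} (f : L2 D) (g : Vilenkin Ds → ℂ) :
    Prop :=
  MemLp g 2 (haar Ds) ∧ ∃ u : ℕ → L2 D, (∀ k, Integrable (u k) (haar D)) ∧
    Tendsto u atTop (𝓝 f) ∧
    Tendsto (fun k => eLpNorm (fun ω => fourier Ds (u k) ω - g ω) 2 (haar Ds)) atTop (𝓝 0)

/-- Walsh polynomials of order `n`: linear combinations of the Walsh functions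
`W_k = χ(γ_[k], ·)`, `0 ≤ k < m^n`. -/
def IsWalshPolynomial (D : DigitSet M) (Ds : DigitSet M.transpose) (n : ℕ)
    (p : Vilenkin Ds → ℂ) : Prop :=
  ∃ β : ℕ → ℂ, ∀ ω, p ω = ∑ k ∈ Finset.range (M.det.natAbs ^ n), β k * chi (gam D k) ω

end Fourier

section Mask

variable {d : ℕ} {A : Matrix (Fin d) (Fin d) ℤ} {Ds : DigitSet A} {n r : ℕ}

/-- The sequence `ξ_0, …, ξ_r` extended to all integer indices by zero digits. -/
noncomputable def ext (ξ : Fin (r + 1) → Digit Ds) (l : ℤ) : Digit Ds :=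
  if h : 0 ≤ l ∧ l ≤ r then ξ ⟨l.toNat, by omega⟩ else 0

/-- The word `a_s a_{s+1} … a_{s+n-1}` of length `n`. -/
def word (n : ℕ) (a : ℤ → Digit Ds) (s : ℤ) : Fin n → Digit Ds := fun i => a (s + (i.val : ℤ))

/-- All windows `(ξ_k, …, ξ_{k+n-2})`, `0 ≤ k ≤ r-n+2`, of length `n-1` are distinct. -/
def DistinctWindows (n : ℕ) (ξ : Fin (r + 1) → Digit Ds) : Prop :=
  ∀ k k' : ℕ, k + n ≤ r + 2 → k' + n ≤ r + 2 → k ≠ k' →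
    word (n - 1) (ext ξ) k ≠ word (n - 1) (ext ξ) k'

/-- `ω_1 … ω_n = ξ_k … ξ_{k+n-1}` for some `k = 0, …, r-n+1`. -/
def IsChainWord (ξ : Fin (r + 1) → Digit Ds) (w : Fin n → Digit Ds) : Prop :=
  ∃ k : ℕ, k + n ≤ r + 1 ∧ w = word n (ext ξ) k

/-- `ω_1 = 0`, and `(ω_2, …, ω_n)` is different from `(ξ_k, …, ξ_{k+n-2})` for all
`k = 1, …, r-n+2`. -/
def IsZeroWord (ξ : Fin (r + 1) → Digit Ds) (w : Fin n → Digit Ds) : Prop :=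
  (∀ i : Fin n, i.val = 0 → w i = 0) ∧
    ∀ k : ℕ, 1 ≤ k → k + n ≤ r + 2 →
      (fun i : Fin (n - 1) => w ⟨i.val + 1, by omega⟩) ≠ word (n - 1) (ext ξ) k

/-- The values `b(ω_1 … ω_n)` of a mask associated with `ξ_0, …, ξ_r`. -/
structure IsAssociatedMask (ξ : Fin (r + 1) → Digit Ds) (b : (Fin n → Digit Ds) → ℂ) : Prop where
  chain : ∀ w, IsChainWord ξ w → b w = 1 ∨ b w = -1
  zeroFirst : ∀ w, IsZeroWord ξ w → b w = 1 ∨ b w = -1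
  zero : b (fun _ => 0) = 1
  other : ∀ w, ¬ IsChainWord ξ w → ¬ IsZeroWord ξ w → b w = 0

/-- The function `m_0(ω) = b(ω_1 … ω_n)`. -/
def mask (b : (Fin n → Digit Ds) → ℂ) (ω : Vilenkin Ds) : ℂ := b (word n ω 1)

/-- The product `∏_{j=1}^∞ m_0(𝓜*^{-j} ω)`. -/
noncomputable def maskProd (b : (Fin n → Digit Ds) → ℂ) (ω : Vilenkin Ds) : ℂ :=
  ∏' j : ℕ, mask b (dil (-((j : ℤ) + 1)) ω)

/-- The element `ξ_0 … ξ_{k-1} , ξ_k … ξ_{k+n-2}`: its coordinate at `j` is `ξ_{j+k-1}` for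
`j ≤ n-1` (with `ξ_l = 0` for `l ≤ -1`), and zero for `j > n-1`. -/
noncomputable def chainPoint (n : ℕ) (ξ : Fin (r + 1) → Digit Ds) (k : ℕ) : Vilenkin Ds :=
  ⟨fun j => if j ≤ (n : ℤ) - 1 then ext ξ (j + k - 1) else 0, by
    refine ⟨-(k : ℤ), fun j hj => ?_⟩
    beta_reduce
    split_ifs
    · exact dif_neg (by omega)
    · rfl⟩

/-- The set `Q` of the elements `0 , α_1 … α_{n-1}` for which `α_1 … α_{n-1}` is different from
`ξ_k … ξ_{k+n-2}` for all `k = 1, …, r-n+2`. -/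
def Q (n : ℕ) (ξ : Fin (r + 1) → Digit Ds) : Set (Vilenkin Ds) :=
  {x | (∀ j ≤ 0, x j = 0) ∧ (∀ j > (n : ℤ) - 1, x j = 0) ∧
    ∀ k : ℕ, 1 ≤ k → k + n ≤ r + 2 → word (n - 1) x 1 ≠ word (n - 1) (ext ξ) k}

/-- The explicit expression for the Fourier transform. -/
noncomputable def explicitFourier (ξ : Fin (r + 1) → Digit Ds) (b : (Fin n → Digit Ds) → ℂ)
    (ω : Vilenkin Ds) : ℂ :=
  (∑ k ∈ Finset.Icc 1 (r - n + 2),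
    Set.indicator ({chainPoint n ξ k} + U Ds ((n : ℤ) - 1)) (fun _ => (1 : ℂ)) ω *
      ∏ j ∈ Finset.Icc 1 (k + n - 1), b (word n (ext ξ) ((k : ℤ) - j))) +
  Set.indicator (Q n ξ + U Ds ((n : ℤ) - 1)) (fun _ => (1 : ℂ)) ω *
    ∏ j ∈ Finset.Icc 1 (n - 1),
      b (word n (fun l => if l ≤ 0 then 0 else ω l) (1 - (j : ℤ)))

end Mask

end GenVilenkin

/-! The factors of $g=\prod_j m_0(\mathcal M^{*-j}\omega)$ are the values of $b$ on the words of
length $n$ in the sequence $\omega$ that begin at the places $0,-1,-2,\dots$. So $g(\omega)\ne0$ is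
a condition that can be followed leftwards from the window $(\omega_1,\dots,\omega_{n-1})$. In a
word with $b\ne0$ the last $n-1$ letters determine the first one. If they form the window of $\xi$
at some $k\ge1$, the first letter is $\xi_{k-1}$, since the windows are distinct. Otherwise the
first letter is $\mathbf 0$. A path that starts in a window $k\ge1$ runs back along $\xi$ to $\xi_0$
and then meets only zeros, because a tail beginning with $\mathbf 0$ is never a window of nonzero
digits. A path that starts outside these windows meets only zeros. This is the content of
`eq_ext_of_maskProd_ne_zero` and `eq_zero_of_maskProd_ne_zero`.

Hence each fractional part $(\omega_j)_{j\ge1}$ admits exactly one integer part with $g\ne0$, and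
there $|g|=1$. The explicit formula (`maskProd_eq_explicitFourier`) and the support in
$U^*_{-(r-n+2)}$ follow. Moreover $|g|^2$ is the indicator of a set obtained from $U^*$ by moving
finitely many pieces by elements of $H^*$ (`conj_maskProd_mul_self`). Characters $\chi(h,\cdot)$
with $h\in H$ do not see such moves, so $\int|g|^2\chi(h,\cdot)=\int_{U^*}\chi(h,\cdot)$, which is
$1$ for $h=\mathbf 0$ and $0$ otherwise. By Plancherel the translates are orthonormal.

The function $\varphi$ is the inverse transform of $g$. Since $g$ is $U^*_{n-1}$-invariant with
compact support, duality makes $\varphi$ a test function (`invFourier_add_of_mem_U`,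
`support_invFourier_subset`), and inversion is an elementary computation with characters
(`fourier_invFourier`). Uniqueness in $L_2$ holds because $g$ determines the integrals of $\varphi$
over all cosets of the $U_l$ (`IsFourierL2.unique`). Refinability is the identity $g=m_0(\mathcal
M^{*-1}\cdot)\,g(\mathcal M^{*-1}\cdot)$ read through the inverse transform; it needs $m_0$ to be a
Walsh polynomial (`isWalshPolynomial_mask`). -/

namespace GenVilenkin

/-! ### Duality between the digits of $M$ and of $M^T$. -/

section Pairing

variable {d : ℕ} {M : Matrix (Fin d) (Fin d) ℤ}

theorem pairing_add_left (x y w : Fin d → ℤ) :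
    pairing M (x + y) w = pairing M x w + pairing M y w := by
  have : (fun i => (((x + y) i : ℤ) : ℝ)) = (fun i => (x i : ℝ)) + fun i => (y i : ℝ) := by
    ext i; simp
  simp only [pairing, this, Matrix.mulVec_add, add_dotProduct]

theorem pairing_add_right (x w v : Fin d → ℤ) :
    pairing M x (w + v) = pairing M x w + pairing M x v := by
  have : (fun i => (((w + v) i : ℤ) : ℝ)) = (fun i => (w i : ℝ)) + fun i => (v i : ℝ) := by
    ext i; simp
  simp only [pairing, this, dotProduct_add]

theorem isUnit_det_map (hM : M.det ≠ 0) : IsUnit (M.map (fun a : ℤ => (a : ℝ))).det := by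
  have : (M.map (fun a : ℤ => (a : ℝ))).det = (M.det : ℝ) :=
    ((Int.castRingHom ℝ).map_det M).symm
  rw [this, isUnit_iff_ne_zero]
  exact_mod_cast hM

theorem cast_mulVec (A : Matrix (Fin d) (Fin d) ℤ) (s : Fin d → ℤ) :
    (fun i => ((A.mulVec s i : ℤ) : ℝ))
      = (A.map (fun a : ℤ => (a : ℝ))).mulVec fun i => (s i : ℝ) := by
  ext i
  simp [Matrix.mulVec, dotProduct]

theorem pairing_mulVec_left (hM : M.det ≠ 0) (s w : Fin d → ℤ) :
    pairing M (M.mulVec s) w = ((s ⬝ᵥ w : ℤ) : ℝ) := by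
  rw [pairing, cast_mulVec, Matrix.mulVec_mulVec, Matrix.nonsing_inv_mul _ (isUnit_det_map hM),
    Matrix.one_mulVec]
  simp [dotProduct]

theorem pairing_eq_dotProduct (x w : Fin d → ℤ) :
    pairing M x w = (fun i => (x i : ℝ)) ⬝ᵥ
      ((M.transpose.map (fun a : ℤ => (a : ℝ)))⁻¹.mulVec fun i => (w i : ℝ)) := by
  have h : (M.transpose.map (fun a : ℤ => (a : ℝ)))⁻¹
      = ((M.map (fun a : ℤ => (a : ℝ)))⁻¹).transpose := by
    rw [Matrix.transpose_nonsing_inv]; rfl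
  rw [pairing, h, Matrix.mulVec_transpose, dotProduct_comm, Matrix.dotProduct_mulVec,
    dotProduct_comm]

theorem pairing_mulVec_right (hM : M.det ≠ 0) (x s : Fin d → ℤ) :
    pairing M x (M.transpose.mulVec s) = ((x ⬝ᵥ s : ℤ) : ℝ) := by
  rw [pairing_eq_dotProduct, cast_mulVec, Matrix.mulVec_mulVec,
    Matrix.nonsing_inv_mul _ (isUnit_det_map (by rwa [Matrix.det_transpose])), Matrix.one_mulVec]
  simp [dotProduct]

/-- Pairing with the standard basis vectors reads off the coordinates of $M^{-1}x$, which are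
therefore integers. -/
theorem exists_mulVec_of_pairing_left (hM : M.det ≠ 0) {x : Fin d → ℤ}
    (h : ∀ w, ∃ c : ℤ, pairing M x w = c) : ∃ s : Fin d → ℤ, x = M.mulVec s := by
  choose c hc using fun i => h (Pi.single i 1)
  refine ⟨c, ?_⟩
  have h1 : (fun i => (c i : ℝ))
      = (M.map (fun a : ℤ => (a : ℝ)))⁻¹.mulVec fun i => (x i : ℝ) := by
    ext i
    rw [← hc i, pairing]
    have : (fun j => (((Pi.single i 1 : Fin d → ℤ) j : ℤ) : ℝ)) = Pi.single i 1 := by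
      ext j; by_cases hj : j = i
      · subst hj; simp
      · simp [hj]
    rw [this, dotProduct_single, mul_one]
  have h2 := cast_mulVec M c
  rw [h1, Matrix.mulVec_mulVec, Matrix.mul_nonsing_inv _ (isUnit_det_map hM),
    Matrix.one_mulVec] at h2
  ext i
  exact_mod_cast (congrFun h2 i).symm

theorem exists_mulVec_of_pairing_right (hM : M.det ≠ 0) {w : Fin d → ℤ}
    (h : ∀ x, ∃ c : ℤ, pairing M x w = c) : ∃ s : Fin d → ℤ, w = M.transpose.mulVec s := by
  choose c hc using fun i => h (Pi.single i 1)
  refine ⟨c, ?_⟩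
  have h1 : (fun i => (c i : ℝ))
      = (M.transpose.map (fun a : ℤ => (a : ℝ)))⁻¹.mulVec fun i => (w i : ℝ) := by
    ext i
    rw [← hc i, pairing_eq_dotProduct]
    have : (fun j => (((Pi.single i 1 : Fin d → ℤ) j : ℤ) : ℝ)) = Pi.single i 1 := by
      ext j; by_cases hj : j = i
      · subst hj; simp
      · simp [hj]
    rw [this, single_dotProduct, one_mul]
  have h2 := cast_mulVec M.transpose c
  rw [h1, Matrix.mulVec_mulVec, Matrix.mul_nonsing_inv _
    (isUnit_det_map (by rwa [Matrix.det_transpose])), Matrix.one_mulVec] at h2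
  ext i
  exact_mod_cast (congrFun h2 i).symm

/-- `exp (2πi⟨M⁻¹ u, v⟩)` for digits `u` of `M` and `v` of `Mᵀ`. -/
noncomputable def digitChar {D : DigitSet M} {Ds : DigitSet M.transpose}
    (u : Digit D) (v : Digit Ds) : ℂ :=
  Complex.exp (2 * Real.pi * Complex.I * ((pairing M u.1 v.1 : ℝ) : ℂ))

theorem exp_eq_of_sub_int {s t : ℝ} {c : ℤ} (h : s - t = c) :
    Complex.exp (2 * Real.pi * Complex.I * (s : ℂ))
      = Complex.exp (2 * Real.pi * Complex.I * (t : ℂ)) := by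
  rw [Complex.exp_eq_exp_iff_exists_int]
  refine ⟨c, ?_⟩
  have : (s : ℂ) = t + c := by
    rw [sub_eq_iff_eq_add] at h
    rw [h]; push_cast; ring
  rw [this]; ring

theorem exists_int_of_exp_eq_one {t : ℝ}
    (h : Complex.exp (2 * Real.pi * Complex.I * (t : ℂ)) = 1) : ∃ c : ℤ, t = c := by
  obtain ⟨c, hc⟩ := Complex.exp_eq_one_iff.1 h
  refine ⟨c, ?_⟩
  have h2 : (2 * Real.pi * Complex.I : ℂ) ≠ 0 := Complex.two_pi_I_ne_zero
  have : (t : ℂ) = c := by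
    apply mul_left_cancel₀ h2
    rw [hc]; ring
  exact_mod_cast this

variable {D : DigitSet M} {Ds : DigitSet M.transpose}

/-- The digit sum differs from the vector sum by some $Ms$, and $\langle M^{-1}Ms,v\rangle$ is an
integer, which the exponential ignores. -/
theorem digitChar_add_left (u u' : Digit D) (v : Digit Ds) :
    digitChar (u + u') v = digitChar u v * digitChar u' v := by
  obtain ⟨s, hs⟩ := Digit.add_congruent u u'
  have h : pairing M (u + u').1 v.1 - pairing M (u.1 + u'.1) v.1 = ((s ⬝ᵥ v.1 : ℤ) : ℝ) := by
    rw [sub_eq_iff_eq_add.1 hs, pairing_add_left, pairing_mulVec_left D.det_ne_zero,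
      add_sub_cancel_right]
  rw [digitChar, exp_eq_of_sub_int h, pairing_add_left, digitChar, digitChar, ← Complex.exp_add]
  congr 1; push_cast; ring

theorem digitChar_add_right (u : Digit D) (v v' : Digit Ds) :
    digitChar u (v + v') = digitChar u v * digitChar u v' := by
  obtain ⟨s, hs⟩ := Digit.add_congruent v v'
  have h : pairing M u.1 (v + v').1 - pairing M u.1 (v.1 + v'.1) = ((u.1 ⬝ᵥ s : ℤ) : ℝ) := by
    rw [sub_eq_iff_eq_add.1 hs, pairing_add_right, pairing_mulVec_right D.det_ne_zero,
      add_sub_cancel_right]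
  rw [digitChar, exp_eq_of_sub_int h, pairing_add_right, digitChar, digitChar, ← Complex.exp_add]
  congr 1; push_cast; ring

@[simp]
theorem pairing_zero_left (w : Fin d → ℤ) : pairing M 0 w = 0 := by
  have := pairing_add_left (M := M) 0 0 w
  rw [add_zero] at this
  linarith

@[simp]
theorem pairing_zero_right (x : Fin d → ℤ) : pairing M x 0 = 0 := by
  have := pairing_add_right (M := M) x 0 0
  rw [add_zero] at this
  linarith

/-- Every integer vector is congruent to a digit. -/
theorem exists_digit_congruent {A : Matrix (Fin d) (Fin d) ℤ} (E : DigitSet A) (x : Fin d → ℤ) :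
    ∃ u : Digit E, Congruent A x u.1 := by
  obtain ⟨u, hu⟩ := (Digit.toQuotient_bijective E).2 (Submodule.Quotient.mk x)
  refine ⟨u, ?_⟩
  have h := hu.symm
  rw [Digit.toQuotient, Submodule.Quotient.eq] at h
  obtain ⟨s, hs⟩ := h
  exact ⟨s, hs.symm⟩

theorem digit_eq_zero_of_mulVec {A : Matrix (Fin d) (Fin d) ℤ} {E : DigitSet A} {u : Digit E}
    {s : Fin d → ℤ} (h : u.1 = A.mulVec s) : u = 0 := by
  apply (Digit.toQuotient_bijective E).1
  rw [Digit.toQuotient, Digit.toQuotient, Submodule.Quotient.eq, Digit.zero_val, sub_zero]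
  exact ⟨s, h.symm⟩

/-- Nondegeneracy: triviality on all digits spreads to all integer vectors, as these are congruent
to digits; then $v\in M^T\mathbb Z^d$, so $v$ is the zero digit. -/
theorem exists_digitChar_ne_one_right {v : Digit Ds} (hv : v ≠ 0) :
    ∃ u : Digit D, digitChar u v ≠ 1 := by
  by_contra! h
  apply hv
  obtain ⟨s, hs⟩ := exists_mulVec_of_pairing_right (M := M) D.det_ne_zero (w := v.1) (by
    intro x
    obtain ⟨u, s, hs⟩ := exists_digit_congruent D x
    obtain ⟨c, hc⟩ := exists_int_of_exp_eq_one (h u)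
    refine ⟨s ⬝ᵥ v.1 + c, ?_⟩
    rw [sub_eq_iff_eq_add.1 hs, pairing_add_left, pairing_mulVec_left D.det_ne_zero, hc]
    push_cast; rfl)
  exact digit_eq_zero_of_mulVec hs

theorem exists_digitChar_ne_one_left {u : Digit D} (hu : u ≠ 0) :
    ∃ v : Digit Ds, digitChar u v ≠ 1 := by
  by_contra! h
  apply hu
  obtain ⟨s, hs⟩ := exists_mulVec_of_pairing_left (M := M) D.det_ne_zero (x := u.1) (by
    intro w
    obtain ⟨v, s, hs⟩ := exists_digit_congruent Ds w
    obtain ⟨c, hc⟩ := exists_int_of_exp_eq_one (h v)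
    refine ⟨u.1 ⬝ᵥ s + c, ?_⟩
    rw [sub_eq_iff_eq_add.1 hs, pairing_add_right, pairing_mulVec_right D.det_ne_zero, hc]
    push_cast; rfl)
  exact digit_eq_zero_of_mulVec hs

theorem card_digit {A : Matrix (Fin d) (Fin d) ℤ} (E : DigitSet A) :
    Nat.card (Digit E) = A.det.natAbs := by
  rw [Nat.card_congr (Digit.equivQuotient E), card_quotient E.det_ne_zero]

end Pairing

/-! ### Topology and Haar measure of the Vilenkin group. -/

section Structure

variable {d : ℕ} {M : Matrix (Fin d) (Fin d) ℤ} {D : DigitSet M}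

@[simp] theorem coe_add (x y : Vilenkin D) (j : ℤ) : (x + y) j = x j + y j := rfl

@[simp] theorem coe_sub (x y : Vilenkin D) (j : ℤ) : (x - y) j = x j - y j := rfl

@[simp] theorem dil_apply (k : ℤ) (x : Vilenkin D) (j : ℤ) : (dil k x) j = x (j + k) := rfl

theorem vilenkin_ext {x y : Vilenkin D} (h : ∀ j, x j = y j) : x = y :=
  Subtype.ext (funext h)

theorem mem_U {l : ℤ} {x : Vilenkin D} : x ∈ U D l ↔ ∀ j ≤ l, x j = 0 := Iff.rfl

theorem sub_mem_U {l : ℤ} {u v : Vilenkin D} (hu : u ∈ U D l) (hv : v ∈ U D l) :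
    u - v ∈ U D l := by
  rw [sub_eq_add_neg]; exact add_mem_U hu (neg_mem_U hv)

theorem sub_mem_U_iff {l : ℤ} {x y : Vilenkin D} : x - y ∈ U D l ↔ ∀ j ≤ l, x j = y j := by
  simp [mem_U, sub_eq_zero]

theorem U_antitone : Antitone (U D) := fun _ _ h _ hx j hj => hx j (hj.trans h)

theorem exists_mem_U (x : Vilenkin D) : ∃ l : ℤ, x ∈ U D l := by
  obtain ⟨N, hN⟩ := x.2
  exact ⟨N - 1, fun j hj => hN j (by omega)⟩

/-- The element with the single (possibly) nonzero coordinate `a` at the place `i`. -/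
noncomputable def single (D : DigitSet M) (i : ℤ) (a : Digit D) : Vilenkin D :=
  ⟨fun j => if j = i then a else 0, i, fun _ hj => if_neg hj.ne⟩

@[simp] theorem single_apply_self (i : ℤ) (a : Digit D) : (single D i a) i = a := if_pos rfl

theorem single_apply_of_ne {i j : ℤ} (h : j ≠ i) (a : Digit D) : (single D i a) j = 0 := if_neg h

theorem single_mem_U {i l : ℤ} (h : l < i) (a : Digit D) : single D i a ∈ U D l :=
  fun _ hj => single_apply_of_ne (by omega) a

/-- The shift `𝓜^k` as an additive equivalence. -/
def dilEquiv (D : DigitSet M) (k : ℤ) : Vilenkin D ≃+ Vilenkin D where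
  toFun := dil k
  invFun := dil (-k)
  left_inv x := vilenkin_ext fun j => by simp
  right_inv x := vilenkin_ext fun j => by simp
  map_add' _ _ := rfl

theorem dil_mem_U {k l : ℤ} {x : Vilenkin D} : dil k x ∈ U D l ↔ x ∈ U D (l + k) := by
  constructor
  · intro h j hj
    have := h (j - k) (by omega)
    simpa using this
  · intro h j hj
    exact h (j + k) (by omega)

theorem image_dil_U (k l : ℤ) : dil k '' U D l = U D (l - k) := by
  ext x
  constructor
  · rintro ⟨y, hy, rfl⟩
    rw [dil_mem_U, sub_add_cancel]; exact hy
  · intro hx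
    exact ⟨dil (-k) x, dil_mem_U.2 (by rwa [← sub_eq_add_neg]), (dilEquiv D k).right_inv x⟩

theorem continuous_dil (k : ℤ) : Continuous (dil k : Vilenkin D → Vilenkin D) := by
  rw [continuous_def]
  intro S hS x hx
  obtain ⟨l, hl⟩ := isOpen_iff.1 hS _ hx
  refine ⟨l + k, fun u hu => ?_⟩
  exact hl (dil k u) (dil_mem_U.2 hu)

theorem isCompact_U (l : ℤ) : IsCompact (U D l) := by
  have := (isCompact_U_zero D).image (continuous_dil (-l))
  rwa [image_dil_U, zero_sub, neg_neg] at this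

theorem measurableSet_U (l : ℤ) : MeasurableSet (U D l) := (isOpen_U D l).measurableSet

/-- A function is continuous if near each point it is invariant under translations by some `U_l`. -/
theorem continuous_of_locally_invariant {X : Type*} [TopologicalSpace X] {f : Vilenkin D → X}
    (h : ∀ x, ∃ l : ℤ, ∀ u ∈ U D l, f (x + u) = f x) : Continuous f := by
  rw [continuous_def]
  intro S _ x hx
  obtain ⟨l, hl⟩ := h x
  refine ⟨l, fun u hu => ?_⟩
  rw [Set.mem_preimage, hl u hu]
  exact hx

theorem hasCompactSupport_of_subset_U {f : Vilenkin D → ℂ} {l : ℤ}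
    (h : Function.support f ⊆ U D l) : HasCompactSupport f :=
  HasCompactSupport.of_support_subset_isCompact (isCompact_U l) h

instance : LocallyCompactSpace (Vilenkin D) :=
  (isCompact_U_zero D).locallyCompactSpace_of_mem_nhds_of_addGroup
    ((isOpen_U D 0).mem_nhds (zero_mem_U D 0))

instance : T2Space (Vilenkin D) := by
  refine IsTopologicalAddGroup.t2Space_of_zero_sep fun x hx => ?_
  by_contra! h
  refine hx (vilenkin_ext fun j => ?_)
  exact h (U D j) ((isOpen_U D j).mem_nhds (zero_mem_U D j)) j le_rfl

/-- The cosets of the subgroups `U_l`. -/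
def cosets (D : DigitSet M) : Set (Set (Vilenkin D)) :=
  Set.range fun p : Vilenkin D × ℤ => {y | y - p.1 ∈ U D p.2}

theorem isTopologicalBasis_cosets : TopologicalSpace.IsTopologicalBasis (cosets D) := by
  refine TopologicalSpace.isTopologicalBasis_of_isOpen_of_nhds ?_ ?_
  · rintro _ ⟨⟨x, l⟩, rfl⟩
    exact isOpen_coset x l
  · intro x S hx hS
    obtain ⟨l, hl⟩ := isOpen_iff.1 hS x hx
    refine ⟨_, ⟨⟨x, l⟩, rfl⟩, ?_, ?_⟩
    · simpa using zero_mem_U D l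
    · intro y hy
      simpa using hl _ hy

/-- The truncation of `x` to the coordinates with indices `≤ l`. -/
noncomputable def trunc (l : ℤ) (x : Vilenkin D) : Vilenkin D :=
  ⟨fun j => if j ≤ l then x j else 0, by
    obtain ⟨N, hN⟩ := x.2
    exact ⟨N, fun j hj => by simp [hN j hj]⟩⟩

theorem trunc_apply (l : ℤ) (x : Vilenkin D) (j : ℤ) :
    (trunc l x) j = if j ≤ l then x j else 0 := rfl

theorem sub_trunc_mem_U (l : ℤ) (x : Vilenkin D) : x - trunc l x ∈ U D l := by
  rw [sub_mem_U_iff]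
  intro j hj
  simp [trunc_apply, hj]

theorem finite_support_trunc (l : ℤ) (x : Vilenkin D) :
    (Function.support fun j => (trunc l x) j).Finite := by
  obtain ⟨N, hN⟩ := x.2
  refine (Set.finite_Icc N l).subset fun j hj => ?_
  rw [Function.mem_support, trunc_apply] at hj
  by_contra h
  apply hj
  rw [Set.mem_Icc, not_and_or, not_le, not_le] at h
  rcases h with h | h
  · simp [hN j h]
  · simp [not_le.2 h]

/-- Every coset of $U_l$ contains a truncation, and finitely supported sequences of digits are
countably many. -/
theorem countable_cosets : (cosets D).Countable := by
  have hc : Set.Countable {c : Vilenkin D | (Function.support fun j => c j).Finite} := by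
    refine Set.MapsTo.countable_of_injOn (t := Set.range fun p : ℤ →₀ Digit D => (p : ℤ → Digit D))
      (f := fun x : Vilenkin D => (fun j => x j)) ?_ ?_ (Set.countable_range _)
    · intro x hx
      exact ⟨Finsupp.ofSupportFinite _ hx, rfl⟩
    · intro x _ y _ h
      exact Subtype.ext h
  have : cosets D ⊆ (fun p : Vilenkin D × ℤ => {y : Vilenkin D | y - p.1 ∈ U D p.2}) ''
      ({c : Vilenkin D | (Function.support fun j => c j).Finite} ×ˢ Set.univ) := by
    rintro _ ⟨⟨x, l⟩, rfl⟩
    refine ⟨⟨trunc l x, l⟩, ⟨finite_support_trunc l x, trivial⟩, ?_⟩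
    ext y
    have h := sub_trunc_mem_U l x
    simp only [Set.mem_ofPred_eq]
    constructor
    · intro hy
      have := sub_mem_U hy h
      rwa [sub_sub_sub_cancel_right] at this
    · intro hy
      have := add_mem_U hy h
      simpa using this
  exact ((hc.prod Set.countable_univ).image _).mono this

/-- This makes continuous functions on $V\times V^*$ measurable for the product $\sigma$-algebra, as
Fubini requires. -/
instance : SecondCountableTopology (Vilenkin D) :=
  isTopologicalBasis_cosets.secondCountableTopology countable_cosets

/-- Two cosets are disjoint or comparable, so the cosets form a `π`-system. -/
theorem coset_subset {x y z : Vilenkin D} {l k : ℤ} (hlk : l ≤ k) (hx : z - x ∈ U D l)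
    (hy : z - y ∈ U D k) : {w | w - y ∈ U D k} ⊆ {w | w - x ∈ U D l} := by
  intro w hw
  have h : w - x = (w - y) - (z - y) + (z - x) := by abel
  change w - x ∈ U D l
  rw [h]
  exact add_mem_U (sub_mem_U (U_antitone hlk hw) (U_antitone hlk hy)) hx

theorem isPiSystem_cosets : IsPiSystem (cosets D) := by
  rintro _ ⟨⟨x, l⟩, rfl⟩ _ ⟨⟨y, k⟩, rfl⟩ ⟨z, hx, hy⟩
  rcases le_total l k with h | h
  · rw [Set.inter_eq_right.2 (coset_subset h hx hy)]
    exact ⟨⟨y, k⟩, rfl⟩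
  · rw [Set.inter_eq_left.2 (coset_subset h hy hx)]
    exact ⟨⟨x, l⟩, rfl⟩

theorem measurableSpace_eq_generateFrom_cosets :
    (inferInstance : MeasurableSpace (Vilenkin D)) = MeasurableSpace.generateFrom (cosets D) :=
  isTopologicalBasis_cosets.borel_eq_generateFrom

theorem haar_U_ne_top (l : ℤ) : haar D (U D l) ≠ ∞ := (isCompact_U l).measure_lt_top.ne

theorem haar_real_U_pos (l : ℤ) : 0 < (haar D).real (U D l) :=
  ENNReal.toReal_pos ((isOpen_U D l).measure_pos _ ⟨0, zero_mem_U D l⟩).ne' (haar_U_ne_top l)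

theorem haar_coset (x : Vilenkin D) (l : ℤ) :
    haar D {y | y - x ∈ U D l} = haar D (U D l) := by
  have : {y | y - x ∈ U D l} = (fun y => y + (-x)) ⁻¹' U D l := by
    ext y; simp [sub_eq_add_neg]
  rw [this, measure_preimage_add_right]

theorem measurableSet_coset (x : Vilenkin D) (l : ℤ) : MeasurableSet {y | y - x ∈ U D l} :=
  (isOpen_coset x l).measurableSet

/-- The digit at the place $l+1$ splits $U_l$ into $m$ disjoint cosets of $U_{l+1}$. -/
theorem haar_real_U_succ (l : ℤ) :
    (haar D).real (U D l) = M.det.natAbs * (haar D).real (U D (l + 1)) := by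
  have : Fintype (Digit D) := Fintype.ofFinite _
  have h : U D l = ⋃ a : Digit D, {y | y - single D (l + 1) a ∈ U D (l + 1)} := by
    ext x
    simp only [Set.mem_iUnion, Set.mem_ofPred_eq, sub_mem_U_iff]
    constructor
    · intro hx
      refine ⟨x (l + 1), fun j hj => ?_⟩
      rcases hj.eq_or_lt with rfl | hj
      · simp
      · rw [hx j (by omega), single_apply_of_ne hj.ne]
    · rintro ⟨a, ha⟩ j hj
      rw [ha j (by omega), single_apply_of_ne (by omega)]
  rw [h, measureReal_iUnion_fintype (h' := fun a => by rw [haar_coset]; exact haar_U_ne_top _)]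
  · simp only [Measure.real, haar_coset, Finset.sum_const, nsmul_eq_mul, Finset.card_univ,
      ← Nat.card_eq_fintype_card, card_digit]
  · intro a b hab
    rw [Function.onFun, Set.disjoint_left]
    intro y ha hb
    rw [Set.mem_ofPred_eq, sub_mem_U_iff] at ha hb
    apply hab
    have h1 := ha (l + 1) le_rfl
    have h2 := hb (l + 1) le_rfl
    simpa [h1] using h2
  · intro a
    exact measurableSet_coset _ _

/-- A function with vanishing integrals over all cosets of the `U_l` vanishes a.e. -/
theorem ae_eq_zero_of_setIntegral_coset_eq_zero {f : Vilenkin D → ℂ}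
    (hf : ∀ l, IntegrableOn f (U D l) (haar D))
    (h : ∀ x l, ∫ y in {y | y - x ∈ U D l}, f y ∂(haar D) = 0) : f =ᵐ[haar D] 0 := by
  -- The $\pi$-$\lambda$ argument is confined to $U_l$, where $f$ is integrable, so that complements
  -- can be subtracted; the $U_l$ exhaust the group afterwards.
  have key : ∀ l : ℤ, ∀ s, MeasurableSet s → ∫ y in s ∩ U D l, f y ∂(haar D) = 0 := by
    intro l s hs
    induction s, hs using MeasurableSpace.induction_on_inter
      measurableSpace_eq_generateFrom_cosets isPiSystem_cosets with
    | empty => simp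
    | basic t ht =>
      obtain ⟨⟨x, k⟩, rfl⟩ := ht
      have hU : U D l = {y | y - (0 : Vilenkin D) ∈ U D l} := by simp
      rcases Set.eq_empty_or_nonempty ({y | y - x ∈ U D k} ∩ U D l) with he | hne
      · simp only [he, setIntegral_empty]
      · have := isPiSystem_cosets _ ⟨⟨x, k⟩, rfl⟩ (U D l) ⟨⟨0, l⟩, hU.symm⟩ hne
        obtain ⟨⟨z, i⟩, hz⟩ := this
        rw [← hz]
        exact h z i
    | compl t htm ih =>
      have hU : ∫ y in U D l, f y ∂(haar D) = 0 := by simpa using h 0 l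
      have h1 := integral_inter_add_sdiff (s := U D l) htm (hf l)
      rw [Set.inter_comm, ih, zero_add, hU] at h1
      rwa [Set.inter_comm, ← Set.sdiff_eq]
    | iUnion g hd hm ih =>
      rw [Set.iUnion_inter, integral_iUnion (fun i => (hm i).inter (measurableSet_U l))
        (fun i j hij => (hd hij).mono Set.inter_subset_left Set.inter_subset_left)
        ((hf l).mono_set (Set.iUnion_subset fun i => Set.inter_subset_right))]
      simp [ih]
  have hU : ⋃ N : ℕ, U D (-(N : ℤ)) = Set.univ := by
    refine Set.eq_univ_of_forall fun x => ?_
    obtain ⟨l, hl⟩ := exists_mem_U x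
    exact Set.mem_iUnion.2 ⟨(-l).toNat, U_antitone (by omega) hl⟩
  rw [← Measure.restrict_univ (μ := haar D), ← hU, Filter.EventuallyEq, ae_restrict_iUnion_iff]
  intro N
  refine Integrable.ae_eq_zero_of_forall_setIntegral_eq_zero (hf _) fun s hs _ => ?_
  rw [Measure.restrict_restrict hs]
  exact key _ s hs

end Structure

/-! ### The characters $\chi(x,\omega)$ and their orthogonality on the subgroups $U_l$. -/

section Character

variable {d : ℕ} {M : Matrix (Fin d) (Fin d) ℤ} {D : DigitSet M} {Ds : DigitSet M.transpose}

/-- The freedom in $S$ lets several values of $\chi$ be expanded over one common finite set, so that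
identities reduce to single digits. -/
theorem chi_eq_prod (x : Vilenkin D) (ω : Vilenkin Ds) {S : Finset ℤ}
    (h : ∀ j, j ∉ S → x j = 0 ∨ ω (1 - j) = 0) :
    chi x ω = ∏ j ∈ S, digitChar (x j) (ω (1 - j)) := by
  have hs : Function.support (fun j : ℤ => pairing M (x j).1 (ω (1 - j)).1) ⊆ S := by
    intro j hj
    by_contra hjS
    apply hj
    rcases h j hjS with h | h <;> simp [h, Digit.zero_val]
  rw [chi, finsum_eq_sum_of_support_subset _ hs]
  simp only [digitChar, ← Complex.exp_sum]
  push_cast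
  rw [Finset.mul_sum]

theorem exists_finset_forall_notMem (x : Vilenkin D) (ω : Vilenkin Ds) :
    ∃ S : Finset ℤ, ∀ j, j ∉ S → x j = 0 ∨ ω (1 - j) = 0 := by
  obtain ⟨l, hl⟩ := exists_mem_U x
  obtain ⟨k, hk⟩ := exists_mem_U ω
  refine ⟨Finset.Icc (l + 1) (-k), fun j hj => ?_⟩
  rw [Finset.mem_Icc, not_and_or] at hj
  rcases hj with h | h
  · exact Or.inl (hl j (by omega))
  · exact Or.inr (hk _ (by omega))

theorem chi_add_left (x y : Vilenkin D) (ω : Vilenkin Ds) :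
    chi (x + y) ω = chi x ω * chi y ω := by
  obtain ⟨S, hS⟩ := exists_finset_forall_notMem x ω
  obtain ⟨T, hT⟩ := exists_finset_forall_notMem y ω
  have hS' : ∀ j, j ∉ S ∪ T → x j = 0 ∨ ω (1 - j) = 0 := fun j hj =>
    hS j fun h => hj (Finset.mem_union_left _ h)
  have hT' : ∀ j, j ∉ S ∪ T → y j = 0 ∨ ω (1 - j) = 0 := fun j hj =>
    hT j fun h => hj (Finset.mem_union_right _ h)
  rw [chi_eq_prod x ω hS', chi_eq_prod y ω hT', chi_eq_prod (x + y) ω (S := S ∪ T),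
    ← Finset.prod_mul_distrib]
  · exact Finset.prod_congr rfl fun j _ => digitChar_add_left _ _ _
  · intro j hj
    rcases hS' j hj with h | h
    · rcases hT' j hj with h' | h'
      · left; simp [h, h']
      · exact Or.inr h'
    · exact Or.inr h

theorem chi_add_right (x : Vilenkin D) (ω ν : Vilenkin Ds) :
    chi x (ω + ν) = chi x ω * chi x ν := by
  obtain ⟨S, hS⟩ := exists_finset_forall_notMem x ω
  obtain ⟨T, hT⟩ := exists_finset_forall_notMem x ν
  have hS' : ∀ j, j ∉ S ∪ T → x j = 0 ∨ ω (1 - j) = 0 := fun j hj =>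
    hS j fun h => hj (Finset.mem_union_left _ h)
  have hT' : ∀ j, j ∉ S ∪ T → x j = 0 ∨ ν (1 - j) = 0 := fun j hj =>
    hT j fun h => hj (Finset.mem_union_right _ h)
  rw [chi_eq_prod x ω hS', chi_eq_prod x ν hT', chi_eq_prod x (ω + ν) (S := S ∪ T),
    ← Finset.prod_mul_distrib]
  · exact Finset.prod_congr rfl fun j _ => digitChar_add_right _ _ _
  · intro j hj
    rcases hS' j hj with h | h
    · exact Or.inl h
    · rcases hT' j hj with h' | h'
      · exact Or.inl h'
      · right; simp [h, h']

theorem chi_eq_one {x : Vilenkin D} {ω : Vilenkin Ds}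
    (h : ∀ j, x j = 0 ∨ ω (1 - j) = 0) : chi x ω = 1 := by
  rw [chi_eq_prod x ω (S := ∅) fun j _ => h j, Finset.prod_empty]

theorem chi_eq_one_of_mem_U {x : Vilenkin D} {ω : Vilenkin Ds} {l k : ℤ} (hx : x ∈ U D l)
    (hω : ω ∈ U Ds k) (h : 0 ≤ l + k) : chi x ω = 1 :=
  chi_eq_one fun j => by
    rcases le_or_gt j l with hj | hj
    · exact Or.inl (hx j hj)
    · exact Or.inr (hω _ (by omega))

/-- The place $j$ is paired with $1-j$, and one of the two is always positive. This is the
$H^*$-periodicity behind orthogonality. -/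
theorem chi_eq_one_of_mem_H {x : Vilenkin D} {ω : Vilenkin Ds} (hx : x ∈ H D)
    (hω : ω ∈ H Ds) : chi x ω = 1 :=
  chi_eq_one fun j => by
    rcases le_or_gt j 0 with hj | hj
    · exact Or.inr (hω _ (by omega))
    · exact Or.inl (hx _ hj)

@[simp] theorem chi_zero_left (ω : Vilenkin Ds) : chi (0 : Vilenkin D) ω = 1 :=
  chi_eq_one fun _ => Or.inl rfl

@[simp] theorem chi_zero_right (x : Vilenkin D) : chi x (0 : Vilenkin Ds) = 1 :=
  chi_eq_one fun _ => Or.inr rfl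

@[simp] theorem norm_chi (x : Vilenkin D) (ω : Vilenkin Ds) : ‖chi x ω‖ = 1 := by
  have h : ∀ t : ℝ, ‖Complex.exp (2 * Real.pi * Complex.I * (t : ℂ))‖ = 1 := fun t => by
    rw [show (2 * Real.pi * Complex.I * (t : ℂ)) = ((2 * Real.pi * t : ℝ) : ℂ) * Complex.I by
      push_cast; ring, Complex.norm_exp_ofReal_mul_I]
  exact h _

theorem chi_ne_zero (x : Vilenkin D) (ω : Vilenkin Ds) : chi x ω ≠ 0 := by
  rw [← norm_ne_zero_iff, norm_chi]; exact one_ne_zero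

theorem conj_chi_mul_self (x : Vilenkin D) (ω : Vilenkin Ds) : conj (chi x ω) * chi x ω = 1 := by
  rw [Complex.conj_mul', norm_chi]; simp

theorem chi_neg_left (x : Vilenkin D) (ω : Vilenkin Ds) : chi (-x) ω = conj (chi x ω) := by
  apply mul_right_cancel₀ (chi_ne_zero x ω)
  rw [← chi_add_left, neg_add_cancel, chi_zero_left, conj_chi_mul_self]

theorem chi_neg_right (x : Vilenkin D) (ω : Vilenkin Ds) : chi x (-ω) = conj (chi x ω) := by
  apply mul_right_cancel₀ (chi_ne_zero x ω)
  rw [← chi_add_right, neg_add_cancel, chi_zero_right, conj_chi_mul_self]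

theorem chi_sub_left (x y : Vilenkin D) (ω : Vilenkin Ds) :
    chi (x - y) ω = chi x ω * conj (chi y ω) := by
  rw [sub_eq_add_neg, chi_add_left, chi_neg_left]

theorem chi_sub_right (x : Vilenkin D) (ω ν : Vilenkin Ds) :
    chi x (ω - ν) = chi x ω * conj (chi x ν) := by
  rw [sub_eq_add_neg, chi_add_right, chi_neg_right]

theorem chi_dil (k : ℤ) (x : Vilenkin D) (ω : Vilenkin Ds) :
    chi (dil k x) (dil (-k) ω) = chi x ω := by
  rw [chi, chi]
  congr 3
  refine finsum_eq_of_bijective (fun j => j + k) (Equiv.addRight k).bijective fun j => ?_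
  simp only [dil_apply, show 1 - j + -k = 1 - (j + k) by ring]

theorem chi_single_left (i : ℤ) (a : Digit D) (ω : Vilenkin Ds) :
    chi (single D i a) ω = digitChar a (ω (1 - i)) := by
  rw [chi_eq_prod _ ω (S := {i}), Finset.prod_singleton, single_apply_self]
  intro j hj
  exact Or.inl (single_apply_of_ne (by simpa using hj) a)

theorem chi_single_right (i : ℤ) (x : Vilenkin D) (a : Digit Ds) :
    chi x (single Ds i a) = digitChar (x (1 - i)) a := by
  rw [chi_eq_prod x _ (S := {1 - i}), Finset.prod_singleton, sub_sub_cancel, single_apply_self]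
  intro j hj
  refine Or.inr (single_apply_of_ne (fun h => hj ?_) a)
  rw [Finset.mem_singleton]; omega

theorem exists_chi_ne_one_right {ω : Vilenkin Ds} {l : ℤ} (h : ω ∉ U Ds (-l)) :
    ∃ u ∈ U D l, chi u ω ≠ 1 := by
  simp only [mem_U, not_forall] at h
  obtain ⟨i, hi, hne⟩ := h
  obtain ⟨a, ha⟩ := exists_digitChar_ne_one_right (D := D) hne
  refine ⟨single D (1 - i) a, single_mem_U (by omega) a, ?_⟩
  rwa [chi_single_left, sub_sub_cancel]

theorem exists_chi_ne_one_left {x : Vilenkin D} {l : ℤ} (h : x ∉ U D (-l)) :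
    ∃ u ∈ U Ds l, chi x u ≠ 1 := by
  simp only [mem_U, not_forall] at h
  obtain ⟨i, hi, hne⟩ := h
  obtain ⟨a, ha⟩ := exists_digitChar_ne_one_left (Ds := Ds) hne
  refine ⟨single Ds (1 - i) a, single_mem_U (by omega) a, ?_⟩
  rwa [chi_single_right, sub_sub_cancel]

theorem continuous_chi : Continuous fun p : Vilenkin D × Vilenkin Ds => chi p.1 p.2 := by
  rw [continuous_iff_continuousAt]
  rintro ⟨x, ω⟩
  obtain ⟨l, hl⟩ := exists_mem_U x
  obtain ⟨k, hk⟩ := exists_mem_U ω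
  -- The bound $-k$ kills the pairing of the increment with $\omega$; the bound $0$, imposed on both
  -- increments, kills their pairing with each other. So $\chi$ is locally constant.
  have h1 : {y | y - x ∈ U D (max 0 (-k))} ∈ 𝓝 x :=
    (isOpen_coset x _).mem_nhds (by simpa using zero_mem_U D _)
  have h2 : {ν | ν - ω ∈ U Ds (max 0 (-l))} ∈ 𝓝 ω :=
    (isOpen_coset ω _).mem_nhds (by simpa using zero_mem_U Ds _)
  refine ContinuousAt.congr (f := fun _ => chi x ω) continuousAt_const ?_
  filter_upwards [prod_mem_nhds h1 h2]
  rintro ⟨y, ν⟩ ⟨hy, hν⟩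
  have e1 : y = x + (y - x) := by abel
  have e2 : ν = ω + (ν - ω) := by abel
  change chi x ω = chi y ν
  rw [e1, e2, chi_add_left, chi_add_right, chi_add_right,
    chi_eq_one_of_mem_U hl hν (by omega), chi_eq_one_of_mem_U hy hk (by omega),
    chi_eq_one_of_mem_U hy hν (by omega)]
  ring

theorem continuous_chi_left (ω : Vilenkin Ds) : Continuous fun x : Vilenkin D => chi x ω := by
  obtain ⟨k, hk⟩ := exists_mem_U ω
  refine continuous_of_locally_invariant fun x => ⟨-k, fun u hu => ?_⟩
  rw [chi_add_left, chi_eq_one_of_mem_U hu hk (by omega), mul_one]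

theorem continuous_chi_right (x : Vilenkin D) : Continuous fun ω : Vilenkin Ds => chi x ω := by
  obtain ⟨k, hk⟩ := exists_mem_U x
  refine continuous_of_locally_invariant fun ω => ⟨-k, fun u hu => ?_⟩
  rw [chi_add_right, chi_eq_one_of_mem_U hk hu (by omega), mul_one]

/-- If $\omega\notin U^*_{-l}$, some $u\in U_l$ has $\chi(u,\omega)\ne1$; translation by $u$
multiplies the integral by this number without changing it. -/
theorem setIntegral_chi_left (l : ℤ) (ω : Vilenkin Ds) :
    ∫ x in U D l, chi x ω ∂(haar D)
      = (U Ds (-l)).indicator (fun _ => ((haar D).real (U D l) : ℂ)) ω := by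
  by_cases h : ω ∈ U Ds (-l)
  · rw [Set.indicator_of_mem h, setIntegral_congr_fun (g := fun _ => (1 : ℂ)) (measurableSet_U l)
      fun x hx => chi_eq_one_of_mem_U hx h (by omega)]
    simp
  · rw [Set.indicator_of_notMem h]
    obtain ⟨u, hu, hne⟩ := exists_chi_ne_one_right (D := D) h
    rw [← integral_indicator (measurableSet_U l)]
    have h1 := integral_add_right_eq_self (μ := haar D)
      ((U D l).indicator fun x => chi x ω) u
    have h2 : ∀ x, (U D l).indicator (fun x => chi x ω) (x + u)
        = chi u ω * (U D l).indicator (fun x => chi x ω) x := by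
      intro x
      by_cases hx : x ∈ U D l
      · rw [Set.indicator_of_mem hx, Set.indicator_of_mem (add_mem_U hx hu), chi_add_left, mul_comm]
      · rw [Set.indicator_of_notMem hx, Set.indicator_of_notMem, mul_zero]
        intro h
        exact hx (by simpa using sub_mem_U h hu)
    simp only [h2, integral_const_mul] at h1
    by_contra h0
    exact hne (mul_right_cancel₀ h0 (by rw [h1, one_mul]))

theorem setIntegral_chi_right (l : ℤ) (x : Vilenkin D) :
    ∫ ω in U Ds l, chi x ω ∂(haar Ds)
      = (U D (-l)).indicator (fun _ => ((haar Ds).real (U Ds l) : ℂ)) x := by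
  by_cases h : x ∈ U D (-l)
  · rw [Set.indicator_of_mem h, setIntegral_congr_fun (g := fun _ => (1 : ℂ)) (measurableSet_U l)
      fun ω hω => chi_eq_one_of_mem_U h hω (by omega)]
    simp
  · rw [Set.indicator_of_notMem h]
    obtain ⟨u, hu, hne⟩ := exists_chi_ne_one_left (Ds := Ds) h
    rw [← integral_indicator (measurableSet_U l)]
    have h1 := integral_add_right_eq_self (μ := haar Ds)
      ((U Ds l).indicator fun ω => chi x ω) u
    have h2 : ∀ ω, (U Ds l).indicator (fun ω => chi x ω) (ω + u)
        = chi x u * (U Ds l).indicator (fun ω => chi x ω) ω := by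
      intro ω
      by_cases hω : ω ∈ U Ds l
      · rw [Set.indicator_of_mem hω, Set.indicator_of_mem (add_mem_U hω hu), chi_add_right, mul_comm]
      · rw [Set.indicator_of_notMem hω, Set.indicator_of_notMem, mul_zero]
        intro h
        exact hω (by simpa using sub_mem_U h hu)
    simp only [h2, integral_const_mul] at h1
    by_contra h0
    exact hne (mul_right_cancel₀ h0 (by rw [h1, one_mul]))

/-- Raising $k$ multiplies one measure by $m$ and divides the other by $m$. This constant makes
Fourier inversion exact. -/
theorem haar_real_U_mul (k : ℕ) :
    (haar D).real (U D (-k)) * (haar Ds).real (U Ds k) = 1 := by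
  induction k with
  | zero => simp [Measure.real, haar_U]
  | succ k ih =>
    have h1 := haar_real_U_succ (D := D) (-((k + 1 : ℕ) : ℤ))
    have h2 := haar_real_U_succ (D := Ds) k
    rw [show -((k + 1 : ℕ) : ℤ) + 1 = -k by push_cast; ring] at h1
    rw [Matrix.det_transpose] at h2
    rw [h2] at ih
    rw [h1, ← ih]
    push_cast
    ring

end Character

/-! ### The multiplication formula and continuity of the transform. -/

section Fourier

variable {d : ℕ} {M : Matrix (Fin d) (Fin d) ℤ} {D : DigitSet M} {Ds : DigitSet M.transpose}

theorem integrable_mul_mul_chi {F : Vilenkin D → ℂ} {G : Vilenkin Ds → ℂ}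
    (hF : Integrable F (haar D)) (hG : Integrable G (haar Ds)) :
    Integrable (fun p : Vilenkin D × Vilenkin Ds => F p.1 * G p.2 * chi p.1 p.2)
      ((haar D).prod (haar Ds)) :=
  (hF.mul_prod hG).mul_bdd (c := 1) continuous_chi.aestronglyMeasurable
    (Eventually.of_forall fun p => (norm_chi p.1 p.2).le)

/-- The multiplication formula. -/
theorem integral_mul_integral_chi {F : Vilenkin D → ℂ} {G : Vilenkin Ds → ℂ}
    (hF : Integrable F (haar D)) (hG : Integrable G (haar Ds)) :
    ∫ x, F x * ∫ ω, G ω * chi x ω ∂(haar Ds) ∂(haar D)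
      = ∫ ω, G ω * ∫ x, F x * chi x ω ∂(haar D) ∂(haar Ds) := by
  simp only [← integral_const_mul]
  rw [integral_integral_swap]
  · refine integral_congr_ae (Eventually.of_forall fun ω => ?_)
    refine integral_congr_ae (Eventually.of_forall fun x => ?_)
    simp only
    ring
  · refine (integrable_mul_mul_chi hF hG).congr (Eventually.of_forall fun p => ?_)
    simp only [Function.uncurry, mul_assoc]

/-- The substitution $x\mapsto-x$ conjugates $\chi$. -/
theorem integral_mul_integral_conj_chi {F : Vilenkin D → ℂ} {G : Vilenkin Ds → ℂ}
    (hF : Integrable F (haar D)) (hG : Integrable G (haar Ds)) :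
    ∫ x, F x * ∫ ω, G ω * conj (chi x ω) ∂(haar Ds) ∂(haar D)
      = ∫ ω, G ω * fourier Ds F ω ∂(haar Ds) := by
  have h := integral_mul_integral_chi (F := fun x => F (-x)) (Ds := Ds) hF.comp_neg hG
  rw [← integral_neg_eq_self] at h
  simp only [neg_neg, chi_neg_left] at h
  rw [h]
  refine integral_congr_ae (Eventually.of_forall fun ω => ?_)
  simp only [fourier]
  rw [← integral_neg_eq_self]
  simp only [neg_neg, chi_neg_left]

theorem continuous_fourier {F : Vilenkin D → ℂ} (hF : Integrable F (haar D)) :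
    Continuous (fourier Ds F) := by
  refine continuous_of_dominated (F := fun ω x => F x * conj (chi x ω)) (bound := fun x => ‖F x‖)
    (fun ω => ?_) (fun ω => Eventually.of_forall fun x => by simp) hF.norm
    (Eventually.of_forall fun x => ?_)
  · exact hF.aestronglyMeasurable.mul
      (Complex.continuous_conj.comp (continuous_chi_left ω)).aestronglyMeasurable
  · exact continuous_const.mul (Complex.continuous_conj.comp (continuous_chi_right x))

end Fourier

/-! ### Combinatorics of the mask product: support, modulus and explicit form. -/

section MaskProduct

variable {d : ℕ} {A : Matrix (Fin d) (Fin d) ℤ} {Ds : DigitSet A} {n r : ℕ}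
  {ξ : Fin (r + 1) → Digit Ds} {b : (Fin n → Digit Ds) → ℂ}

theorem ext_of_neg {l : ℤ} (h : l < 0) : ext ξ l = 0 := dif_neg (by omega)

theorem ext_ne_zero (hξ : ∀ i, ξ i ≠ 0) {l : ℤ} (h : 0 ≤ l) (h' : l ≤ r) : ext ξ l ≠ 0 := by
  rw [ext, dif_pos ⟨h, h'⟩]; exact hξ _

theorem word_eq_word_iff {p : ℕ} {a c : ℤ → Digit Ds} {s t : ℤ} :
    word p a s = word p c t ↔ ∀ i : ℕ, i < p → a (s + i) = c (t + i) :=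
  ⟨fun h i hi => congrFun h ⟨i, hi⟩, fun h => funext fun i => h i i.2⟩

/-- Walking leftwards through $\omega$, the tail of a word is already known and the head is the new
letter. -/
theorem word_eq_word_iff_head_tail (hn : 1 ≤ n) {a c : ℤ → Digit Ds} {s t : ℤ} :
    word n a s = word n c t ↔
      a s = c t ∧ word (n - 1) a (s + 1) = word (n - 1) c (t + 1) := by
  simp only [word_eq_word_iff]
  constructor
  · intro h
    refine ⟨by simpa using h 0 (by omega), fun i hi => ?_⟩
    have := h (i + 1) (by omega)
    rw [show s + 1 + i = s + (i + 1 : ℕ) by push_cast; ring,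
      show t + 1 + i = t + (i + 1 : ℕ) by push_cast; ring]
    exact this
  · rintro ⟨h0, h⟩ i hi
    rcases i with _ | i
    · simpa using h0
    · have := h i (by omega)
      rw [show s + 1 + i = s + (i + 1 : ℕ) by push_cast; ring,
        show t + 1 + i = t + (i + 1 : ℕ) by push_cast; ring] at this
      exact this

theorem isChainWord_word_iff (hn : 1 ≤ n) {a : ℤ → Digit Ds} {s : ℤ} :
    IsChainWord ξ (word n a s) ↔ ∃ k : ℕ, k + n ≤ r + 1 ∧ a s = ext ξ k ∧
      word (n - 1) a (s + 1) = word (n - 1) (ext ξ) ((k + 1 : ℕ) : ℤ) := by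
  simp only [IsChainWord, word_eq_word_iff_head_tail hn]
  push_cast
  rfl

theorem isZeroWord_word_iff (hn : 1 ≤ n) {a : ℤ → Digit Ds} {s : ℤ} :
    IsZeroWord ξ (word n a s) ↔ a s = 0 ∧ ∀ k : ℕ, 1 ≤ k → k + n ≤ r + 2 →
      word (n - 1) a (s + 1) ≠ word (n - 1) (ext ξ) k := by
  have htail : (fun i : Fin (n - 1) => word n a s ⟨i.val + 1, by omega⟩)
      = word (n - 1) a (s + 1) := by
    funext i
    simp only [word]
    congr 1
    push_cast
    ring
  rw [IsZeroWord, htail]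
  refine and_congr_left fun _ => ⟨fun h => ?_, fun h i hi => ?_⟩
  · simpa [word] using h ⟨0, by omega⟩ rfl
  · simp [word, hi, h]

theorem mask_dil (b : (Fin n → Digit Ds) → ℂ) (ω : Vilenkin Ds) (j : ℕ) :
    mask b (dil (-((j : ℤ) + 1)) ω) = b (word n ω (1 - ((j + 1 : ℕ) : ℤ))) := by
  rw [mask]
  congr 1
  funext i
  exact congrArg ω.1 (by push_cast; ring)

theorem word_eq_zero {p : ℕ} {a : ℤ → Digit Ds} {s : ℤ} (h : ∀ i < s + p, a i = 0) :
    word p a s = fun _ => 0 :=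
  funext fun i => h _ (by have := i.2; omega)

/-- The word of the factor $j$ ends at the place $n-j$, so for $j>N$ it is the zero word and
contributes $1$. -/
theorem maskProd_eq_prod (hb : b (fun _ => 0) = 1) {ω : Vilenkin Ds} {N : ℕ}
    (h : ∀ i < (n : ℤ) - N, ω i = 0) :
    maskProd b ω = ∏ j ∈ Finset.Icc 1 N, b (word n ω (1 - (j : ℤ))) := by
  have h1 : ∀ K : ℕ, ∏ j ∈ Finset.range K, b (word n ω (1 - ((j + 1 : ℕ) : ℤ)))
      = ∏ j ∈ Finset.Icc 1 K, b (word n ω (1 - (j : ℤ))) := by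
    intro K
    induction K with
    | zero => simp
    | succ K ih => rw [Finset.prod_range_succ, ih, Finset.prod_Icc_succ_top (by omega)]
  rw [maskProd, tprod_eq_prod (s := Finset.range N), ← h1]
  · exact Finset.prod_congr rfl fun j _ => mask_dil b ω j
  · intro j hj
    rw [Finset.mem_range, not_lt] at hj
    rw [mask_dil, word_eq_zero, hb]
    intro i hi
    exact h i (by push_cast at hi; omega)

theorem exists_forall_eq_zero (n : ℕ) (ω : Vilenkin Ds) :
    ∃ N : ℕ, ∀ K : ℕ, N ≤ K → ∀ i < (n : ℤ) - K, ω i = 0 := by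
  obtain ⟨l, hl⟩ := exists_mem_U ω
  exact ⟨(n - l).toNat, fun K hK i hi => hl i (by omega)⟩

/-- The infinite product equals a finite one, which may be taken long enough to contain the factor
of any prescribed $s\le0$. -/
theorem mask_word_ne_zero_of_maskProd_ne_zero (hb : b (fun _ => 0) = 1) {ω : Vilenkin Ds}
    (h : maskProd b ω ≠ 0) {s : ℤ} (hs : s ≤ 0) : b (word n ω s) ≠ 0 := by
  obtain ⟨N, hN⟩ := exists_forall_eq_zero n ω
  rw [maskProd_eq_prod hb (hN (max N (1 - s).toNat) (le_max_left _ _)),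
    Finset.prod_ne_zero_iff] at h
  have := h (1 - s).toNat (Finset.mem_Icc.2 ⟨by omega, le_max_right _ _⟩)
  rwa [show 1 - (((1 - s).toNat : ℕ) : ℤ) = s by omega] at this

theorem maskProd_eq_mask_mul (hb : b (fun _ => 0) = 1) (ω : Vilenkin Ds) :
    maskProd b ω = mask b (dil (-1) ω) * maskProd b (dil (-1) ω) := by
  obtain ⟨N, hN⟩ := exists_forall_eq_zero n ω
  have h1 : (fun j : ℕ => mask b (dil (-(((j + 1 : ℕ) : ℤ) + 1)) ω))
      = fun j : ℕ => mask b (dil (-((j : ℤ) + 1)) (dil (-1) ω)) := by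
    funext j
    congr 1
    refine vilenkin_ext fun i => ?_
    exact congrArg ω.1 (by push_cast; ring)
  have hm : Multipliable fun j : ℕ => mask b (dil (-(((j + 1 : ℕ) : ℤ) + 1)) ω) := by
    refine multipliable_of_ne_finset_one (s := Finset.range N) fun j hj => ?_
    rw [Finset.mem_range, not_lt] at hj
    rw [mask_dil, word_eq_zero, hb]
    intro i hi
    exact hN N le_rfl i (by push_cast at hi; omega)
  have key := tprod_eq_zero_mul' (f := fun j : ℕ => mask b (dil (-((j : ℤ) + 1)) ω)) hm
  simp only [Nat.cast_zero, zero_add] at key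
  rw [maskProd, maskProd, key]
  exact congrArg _ (tprod_congr fun j => congrFun h1 j)

/-- Where the mask product does not vanish and the digits after the point form a window of `ξ`,
all preceding digits continue this window along `ξ`. -/
theorem eq_ext_of_maskProd_ne_zero (hn : 2 ≤ n) (hξ : ∀ i, ξ i ≠ 0) (hw : DistinctWindows n ξ)
    (hb : IsAssociatedMask ξ b) {ω : Vilenkin Ds} (h : maskProd b ω ≠ 0) {k : ℕ}
    (hkr : k + n ≤ r + 2)
    (hwin : word (n - 1) ω 1 = word (n - 1) (ext ξ) k) :
    ∀ j ≤ (n : ℤ) - 1, ω j = ext ξ (j + k - 1) := by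
  have key : ∀ i : ℕ, word (n - 1) ω (1 - (i : ℤ)) = word (n - 1) (ext ξ) ((k : ℤ) - i) := by
    intro i
    induction i with
    | zero => simpa using hwin
    | succ i ih =>
      have hne := mask_word_ne_zero_of_maskProd_ne_zero hb.zero h (s := -(i : ℤ)) (by omega)
      have hhead : ω (-(i : ℤ)) = ext ξ ((k : ℤ) - i - 1) := by
        by_contra hcon
        apply hne
        apply hb.other
        · rw [isChainWord_word_iff (by omega)]
          rintro ⟨k', hk', hhead, htail⟩
          rw [show -(i : ℤ) + 1 = 1 - i by ring, ih] at htail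
          -- For $i\le k$ the tail is the window at $k-i$, and distinctness forces $k'+1=k-i$. For
          -- $i>k$ it begins with a padding zero, while the window at $k'+1$ begins with a nonzero
          -- digit.
          rcases le_or_gt i k with hik | hik
          · rw [← Nat.cast_sub hik] at htail
            by_cases hkk : k - i = k' + 1
            · apply hcon
              rw [hhead]
              congr 1
              omega
            · exact hw _ _ (by omega) (by omega) hkk htail
          · have := word_eq_word_iff.1 htail 0 (by omega)
            rw [ext_of_neg (by omega)] at this
            exact ext_ne_zero hξ (by omega) (by omega) this.symm
        · rw [isZeroWord_word_iff (by omega)]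
          rintro ⟨hhead, htail⟩
          rw [show -(i : ℤ) + 1 = 1 - i by ring, ih] at htail
          -- For $i<k$ the tail is a window with index at least $1$, which a zero word excludes.
          -- From $i=k$ on the required letter is $\mathbf 0$ anyway.
          rcases lt_or_ge i k with hik | hik
          · exact htail (k - i) (by omega) (by omega) (by rw [Nat.cast_sub hik.le])
          · exact hcon (by rw [hhead, ext_of_neg (by omega)])
      rw [word_eq_word_iff] at ih ⊢
      intro p hp
      rcases p with _ | p
      · convert hhead using 2 <;> (push_cast; ring)
      · have := ih p (by omega)
        convert this using 2 <;> (push_cast; ring)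
  intro j hj
  rcases le_or_gt j 1 with hj1 | hj1
  · have := word_eq_word_iff.1 (key (1 - j).toNat) 0 (by omega)
    convert this using 2 <;> omega
  · have := word_eq_word_iff.1 hwin (j - 1).toNat (by omega)
    convert this using 2 <;> omega

/-- Where the mask product does not vanish and the digits after the point do not form a window of
`ξ`, all digits before the point are zero. -/
theorem eq_zero_of_maskProd_ne_zero (hn : 2 ≤ n) (hξ : ∀ i, ξ i ≠ 0)
    (hb : IsAssociatedMask ξ b) {ω : Vilenkin Ds} (h : maskProd b ω ≠ 0)
    (hwin : ∀ k : ℕ, 1 ≤ k → k + n ≤ r + 2 → word (n - 1) ω 1 ≠ word (n - 1) (ext ξ) k) :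
    ∀ j ≤ 0, ω j = 0 := by
  have key : ∀ i : ℕ, ω (-(i : ℤ)) = 0 := by
    intro i
    induction i with
    | zero =>
      by_contra hcon
      refine mask_word_ne_zero_of_maskProd_ne_zero hb.zero h (s := 0) le_rfl (hb.other _ ?_ ?_)
      · rw [isChainWord_word_iff (by omega)]
        rintro ⟨k', hk', -, htail⟩
        exact hwin (k' + 1) (by omega) (by omega) htail
      · rw [isZeroWord_word_iff (by omega)]
        rintro ⟨h0, -⟩
        exact hcon (by simpa using h0)
    | succ i ih =>
      by_contra hcon
      refine mask_word_ne_zero_of_maskProd_ne_zero hb.zero h (s := -((i + 1 : ℕ) : ℤ)) (by omega)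
        (hb.other _ ?_ ?_)
      · rw [isChainWord_word_iff (by omega)]
        rintro ⟨k', hk', -, htail⟩
        have := word_eq_word_iff.1 htail 0 (by omega)
        rw [show -((i + 1 : ℕ) : ℤ) + 1 + (0 : ℕ) = -(i : ℤ) by push_cast; ring, ih] at this
        exact ext_ne_zero hξ (by omega) (by omega) this.symm
      · rw [isZeroWord_word_iff (by omega)]
        rintro ⟨h0, -⟩
        exact hcon h0
  intro j hj
  have := key (-j).toNat
  rwa [show -(((-j).toNat : ℕ) : ℤ) = j by omega] at this

theorem mem_chainPoint_add_U {k : ℕ} {ω : Vilenkin Ds} :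
    ω ∈ {chainPoint n ξ k} + U Ds ((n : ℤ) - 1) ↔
      ∀ j ≤ (n : ℤ) - 1, ω j = ext ξ (j + k - 1) := by
  rw [Set.singleton_add, Set.image_add_left, Set.mem_preimage, neg_add_eq_sub, sub_mem_U_iff]
  refine forall₂_congr fun j hj => ?_
  rw [show (chainPoint n ξ k) j = ext ξ (j + k - 1) from if_pos hj]

theorem mem_Q_add_U (hn : 1 ≤ n) {ω : Vilenkin Ds} :
    ω ∈ Q n ξ + U Ds ((n : ℤ) - 1) ↔ (∀ j ≤ 0, ω j = 0) ∧
      ∀ k : ℕ, 1 ≤ k → k + n ≤ r + 2 → word (n - 1) ω 1 ≠ word (n - 1) (ext ξ) k := by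
  have hword : ∀ {x y : Vilenkin Ds}, (∀ j ≤ (n : ℤ) - 1, x j = y j) →
      word (n - 1) x 1 = word (n - 1) y 1 := fun h =>
    word_eq_word_iff.2 fun i hi => h _ (by omega)
  constructor
  · rintro ⟨q, ⟨h0, -, hq⟩, u, hu, rfl⟩
    have hj : ∀ j ≤ (n : ℤ) - 1, (q + u) j = q j := fun j hj => by rw [coe_add, hu j hj, add_zero]
    refine ⟨fun j hj0 => ?_, fun k hk hkr => ?_⟩
    · rw [hj j (by omega), h0 j hj0]
    · have := hq k hk hkr
      rwa [← hword hj] at this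
  · rintro ⟨h0, hq⟩
    refine ⟨trunc ((n : ℤ) - 1) ω, ⟨fun j hj => ?_, fun j hj => if_neg (by omega), ?_⟩,
      ω - trunc ((n : ℤ) - 1) ω, sub_trunc_mem_U _ ω, by simp⟩
    · rw [trunc_apply, h0 j hj, ite_self]
    · intro k hk hkr
      rw [hword (y := ω) fun j hj => if_pos hj]
      exact hq k hk hkr

/-- The digits of `ω` at the places `1, …, n - 1` form the window of `ξ` at `k`. -/
theorem word_eq_of_mem_chainPoint_add_U {k : ℕ} {ω : Vilenkin Ds}
    (h : ∀ j ≤ (n : ℤ) - 1, ω j = ext ξ (j + k - 1)) :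
    word (n - 1) ω 1 = word (n - 1) (ext ξ) k := by
  rw [word_eq_word_iff]
  intro i hi
  rw [h _ (by omega)]
  congr 1
  ring

theorem maskProd_of_chain (hb : b (fun _ => 0) = 1) {k : ℕ} {ω : Vilenkin Ds}
    (h : ∀ j ≤ (n : ℤ) - 1, ω j = ext ξ (j + k - 1)) :
    maskProd b ω = ∏ j ∈ Finset.Icc 1 (k + n - 1), b (word n (ext ξ) ((k : ℤ) - j)) := by
  rw [maskProd_eq_prod hb (N := k + n - 1)]
  · refine Finset.prod_congr rfl fun j hj => ?_
    rw [Finset.mem_Icc] at hj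
    congr 1
    rw [word_eq_word_iff]
    intro i hi
    rw [h _ (by omega)]
    congr 1
    ring
  · intro i hi
    rw [h i (by omega), ext_of_neg (by omega)]

theorem maskProd_of_forall_le_zero (hb : b (fun _ => 0) = 1) {ω : Vilenkin Ds}
    (h : ∀ j ≤ 0, ω j = 0) :
    maskProd b ω = ∏ j ∈ Finset.Icc 1 (n - 1),
      b (word n (fun l => if l ≤ 0 then 0 else ω l) (1 - (j : ℤ))) := by
  have hω : (fun l => if l ≤ 0 then 0 else ω l) = fun l => ω l := by
    funext l
    split_ifs with hl
    · exact (h l hl).symm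
    · rfl
  rw [hω]
  exact maskProd_eq_prod hb fun i hi => h i (by omega)

/-- The mask takes the values `±1` on the words of `ξ` extended by zeros to the left. -/
theorem norm_mask_word_ext (hn : 2 ≤ n) (hξ : ∀ i, ξ i ≠ 0) (hw : DistinctWindows n ξ)
    (hb : IsAssociatedMask ξ b) {s : ℤ} (hs : s + n ≤ r + 1) : ‖b (word n (ext ξ) s)‖ = 1 := by
  have h1 : b (word n (ext ξ) s) = 1 ∨ b (word n (ext ξ) s) = -1 := by
    rcases le_or_gt 0 s with h0 | h0
    · exact hb.chain _ ⟨s.toNat, by omega, by rw [Int.toNat_of_nonneg h0]⟩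
    · refine hb.zeroFirst _ ((isZeroWord_word_iff (by omega)).2 ⟨ext_of_neg h0, ?_⟩)
      intro k hk hkr heq
      -- For $s=-1$ the tail is the window at $0$, which differs from those with $k\ge1$ only by
      -- distinctness; for smaller $s$ the tail starts with $\mathbf 0$.
      rcases eq_or_ne (s + 1) 0 with h | h
      · rw [h] at heq
        exact hw 0 k (by omega) hkr (by omega) heq
      · have := word_eq_word_iff.1 heq 0 (by omega)
        rw [ext_of_neg (by omega)] at this
        exact ext_ne_zero hξ (by omega) (by omega) this.symm
  rcases h1 with h | h <;> simp [h]

theorem norm_maskProd_of_chain (hn : 2 ≤ n) (hξ : ∀ i, ξ i ≠ 0) (hw : DistinctWindows n ξ)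
    (hb : IsAssociatedMask ξ b) {k : ℕ} (hk : k + n ≤ r + 2) {ω : Vilenkin Ds}
    (h : ∀ j ≤ (n : ℤ) - 1, ω j = ext ξ (j + k - 1)) : ‖maskProd b ω‖ = 1 := by
  rw [maskProd_of_chain hb.zero h, norm_prod]
  refine Finset.prod_eq_one fun j hj => norm_mask_word_ext hn hξ hw hb ?_
  rw [Finset.mem_Icc] at hj
  omega

theorem norm_maskProd_of_mem_Q (hn : 2 ≤ n) (hξ : ∀ i, ξ i ≠ 0)
    (hb : IsAssociatedMask ξ b) {ω : Vilenkin Ds} (h : ∀ j ≤ 0, ω j = 0)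
    (hwin : ∀ k : ℕ, 1 ≤ k → k + n ≤ r + 2 → word (n - 1) ω 1 ≠ word (n - 1) (ext ξ) k) :
    ‖maskProd b ω‖ = 1 := by
  rw [maskProd_eq_prod hb.zero (N := n) fun i hi => h i (by omega), norm_prod]
  refine Finset.prod_eq_one fun j hj => ?_
  rw [Finset.mem_Icc] at hj
  have h1 : b (word n ω (1 - (j : ℤ))) = 1 ∨ b (word n ω (1 - (j : ℤ))) = -1 := by
    refine hb.zeroFirst _ ((isZeroWord_word_iff (by omega)).2 ⟨h _ (by omega), ?_⟩)
    intro k hk hkr heq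
    rcases eq_or_ne j 1 with rfl | hj1
    · exact hwin k hk hkr (by simpa using heq)
    · have := word_eq_word_iff.1 heq 0 (by omega)
      rw [h _ (by omega)] at this
      exact ext_ne_zero hξ (by omega) (by omega) this.symm
  rcases h1 with h | h <;> simp [h]

/-- The window $(\omega_1,\dots,\omega_{n-1})$ selects at most one summand: the term of $k$ if it is
the window at $k$, the term of $Q$ if it is none of them. -/
theorem maskProd_eq_explicitFourier (hn : 2 ≤ n) (hr : n ≤ r) (hξ : ∀ i, ξ i ≠ 0)
    (hw : DistinctWindows n ξ) (hb : IsAssociatedMask ξ b) (ω : Vilenkin Ds) :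
    maskProd b ω = explicitFourier ξ b ω := by
  classical
  rw [explicitFourier]
  simp only [Set.indicator_apply, mem_chainPoint_add_U, mem_Q_add_U (show 1 ≤ n by omega)]
  by_cases hwin : ∃ k : ℕ, 1 ≤ k ∧ k + n ≤ r + 2 ∧ word (n - 1) ω 1 = word (n - 1) (ext ξ) k
  · obtain ⟨k, hk1, hk2, hk⟩ := hwin
    rw [if_neg (fun h => h.2 k hk1 hk2 hk), zero_mul, add_zero, Finset.sum_eq_single k]
    · split_ifs with h
      · rw [maskProd_of_chain hb.zero h, one_mul]
      · rw [zero_mul]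
        by_contra hne
        exact h (eq_ext_of_maskProd_ne_zero hn hξ hw hb hne hk2 hk)
    · intro k' hk' hne
      rw [Finset.mem_Icc] at hk'
      rw [if_neg, zero_mul]
      intro h
      exact hw k' k (by omega) hk2 hne ((word_eq_of_mem_chainPoint_add_U h).symm.trans hk)
    · intro h
      exact absurd (Finset.mem_Icc.2 ⟨hk1, by omega⟩) h
  · push Not at hwin
    rw [Finset.sum_eq_zero, zero_add]
    · split_ifs with h
      · rw [maskProd_of_forall_le_zero hb.zero h.1, one_mul]
      · rw [zero_mul]
        by_contra hne
        exact h ⟨eq_zero_of_maskProd_ne_zero hn hξ hb hne hwin, hwin⟩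
    · intro k hk
      rw [Finset.mem_Icc] at hk
      rw [if_neg, zero_mul]
      intro h
      exact hwin k hk.1 (by omega) (word_eq_of_mem_chainPoint_add_U h)

theorem maskProd_add_of_mem_U (b : (Fin n → Digit Ds) → ℂ) (ω : Vilenkin Ds) {u : Vilenkin Ds}
    (hu : u ∈ U Ds ((n : ℤ) - 1)) : maskProd b (ω + u) = maskProd b ω := by
  rw [maskProd, maskProd]
  congr 1
  funext j
  rw [mask_dil, mask_dil]
  congr 1
  rw [word_eq_word_iff]
  intro i hi
  rw [coe_add, hu _ (by push_cast; omega), add_zero]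

/-- The integer part of a chain point has $k$ digits $\xi_0,\dots,\xi_{k-1}$, and $r-n+2$ is the
largest $k$. -/
theorem support_maskProd_subset (hn : 2 ≤ n) (hξ : ∀ i, ξ i ≠ 0)
    (hw : DistinctWindows n ξ) (hb : IsAssociatedMask ξ b) (hr : n ≤ r) :
    Function.support (maskProd b) ⊆ U Ds (-((r : ℤ) - n + 2)) := by
  intro ω hω j hj
  by_cases hwin : ∃ k : ℕ, 1 ≤ k ∧ k + n ≤ r + 2 ∧ word (n - 1) ω 1 = word (n - 1) (ext ξ) k
  · obtain ⟨k, hk1, hk2, hk⟩ := hwin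
    rw [eq_ext_of_maskProd_ne_zero hn hξ hw hb hω hk2 hk j (by omega), ext_of_neg (by omega)]
  · push Not at hwin
    exact eq_zero_of_maskProd_ne_zero hn hξ hb hω hwin j (by omega)

/-- The part of `chainPoint n ξ k` before the point. -/
noncomputable def chainInt (n : ℕ) (ξ : Fin (r + 1) → Digit Ds) (k : ℕ) : Vilenkin Ds :=
  trunc 0 (chainPoint n ξ k)

theorem chainInt_mem_H (k : ℕ) : chainInt n ξ k ∈ H Ds := fun _ hj => if_neg (by omega)

theorem sub_chainPoint_mem_U {k : ℕ} {ω : Vilenkin Ds} :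
    ω - chainPoint n ξ k ∈ U Ds ((n : ℤ) - 1) ↔
      ∀ j ≤ (n : ℤ) - 1, ω j = ext ξ (j + k - 1) := by
  rw [← mem_chainPoint_add_U, Set.singleton_add, Set.image_add_left, Set.mem_preimage,
    neg_add_eq_sub]

/-- Removing the integer part of the chain point moves its coset into $U^*$, onto the piece where
the window at $k$ appears. -/
theorem add_chainInt_sub_chainPoint_mem_U (hn : 1 ≤ n) {k : ℕ} {ω : Vilenkin Ds} :
    ω + chainInt n ξ k - chainPoint n ξ k ∈ U Ds ((n : ℤ) - 1) ↔
      ω ∈ U Ds 0 ∧ word (n - 1) ω 1 = word (n - 1) (ext ξ) k := by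
  have hneg : ∀ j ≤ 0, (chainInt n ξ k) j = ext ξ (j + k - 1) := fun j hj => by
    rw [chainInt, trunc_apply, if_pos hj]
    exact if_pos (by omega)
  have hpos : ∀ j > 0, (chainInt n ξ k) j = 0 := chainInt_mem_H k
  rw [sub_chainPoint_mem_U, word_eq_word_iff]
  constructor
  · intro h
    refine ⟨fun j hj => ?_, fun i hi => ?_⟩
    · have := h j (by omega)
      rwa [coe_add, hneg j hj, add_eq_right] at this
    · have := h (1 + i) (by omega)
      rw [coe_add, hpos _ (by omega), add_zero] at this
      rw [this]
      congr 1
      ring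
  · rintro ⟨h0, h⟩ j hj
    rcases le_or_gt j 0 with hj0 | hj0
    · rw [coe_add, hneg j hj0, h0 j hj0, zero_add]
    · have := h (j - 1).toNat (by omega)
      rw [show (1 : ℤ) + (j - 1).toNat = j by omega] at this
      rw [coe_add, hpos j hj0, add_zero, this]
      congr 1
      omega

/-- `|∏_j m_0(𝓜*^{-j} ω)|²` is the indicator function of a set congruent to `U` modulo `H`. -/
theorem conj_maskProd_mul_self (hn : 2 ≤ n) (hξ : ∀ i, ξ i ≠ 0)
    (hw : DistinctWindows n ξ) (hb : IsAssociatedMask ξ b) (hr : n ≤ r) (ω : Vilenkin Ds) :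
    conj (maskProd b ω) * maskProd b ω = (U Ds 0).indicator (fun _ => (1 : ℂ)) ω +
      ∑ k ∈ Finset.Icc 1 (r - n + 2),
        ({y | y - chainPoint n ξ k ∈ U Ds ((n : ℤ) - 1)}.indicator (fun _ => (1 : ℂ)) ω -
          {y | y - chainPoint n ξ k ∈ U Ds ((n : ℤ) - 1)}.indicator (fun _ => (1 : ℂ))
            (ω + chainInt n ξ k)) := by
  classical
  simp only [Set.indicator_apply, Set.mem_ofPred_eq, add_chainInt_sub_chainPoint_mem_U
    (show 1 ≤ n by omega)]
  simp only [sub_chainPoint_mem_U, Complex.conj_mul']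
  by_cases hwin : ∃ k : ℕ, 1 ≤ k ∧ k + n ≤ r + 2 ∧ word (n - 1) ω 1 = word (n - 1) (ext ξ) k
  · obtain ⟨k, hk1, hk2, hk⟩ := hwin
    rw [Finset.sum_eq_single k]
    -- With this window the subtracted term cancels the indicator of $U^*$, leaving only the moved
    -- piece.
    · have hB : (ω ∈ U Ds 0 ∧ word (n - 1) ω 1 = word (n - 1) (ext ξ) k) ↔ ω ∈ U Ds 0 :=
        and_iff_left hk
      simp only [hB, add_sub_cancel]
      split_ifs with h
      · rw [norm_maskProd_of_chain hn hξ hw hb hk2 h]; simp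
      · have : maskProd b ω = 0 := by
          by_contra hne
          exact h (eq_ext_of_maskProd_ne_zero hn hξ hw hb hne hk2 hk)
        simp [this]
    · intro k' hk' hne
      rw [Finset.mem_Icc] at hk'
      have hne' : word (n - 1) ω 1 ≠ word (n - 1) (ext ξ) k' := fun h =>
        hw k' k (by omega) hk2 hne (h.symm.trans hk)
      rw [if_neg (fun h => hne' (word_eq_of_mem_chainPoint_add_U h)), if_neg (fun h => hne' h.2),
        sub_zero]
    · intro h
      exact absurd (Finset.mem_Icc.2 ⟨hk1, by omega⟩) h
  · push Not at hwin
    rw [Finset.sum_eq_zero, add_zero]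
    · split_ifs with h
      · rw [norm_maskProd_of_mem_Q hn hξ hb h hwin]; simp
      · have : maskProd b ω = 0 := by
          by_contra hne
          exact h (eq_zero_of_maskProd_ne_zero hn hξ hb hne hwin)
        simp [this]
    · intro k hk
      rw [Finset.mem_Icc] at hk
      have hne' := hwin k hk.1 (by omega)
      rw [if_neg (fun h => hne' (word_eq_of_mem_chainPoint_add_U h)), if_neg (fun h => hne' h.2),
        sub_zero]

end MaskProduct

/-! ### Inversion for test functions and uniqueness in $L_2$. -/

section InverseFourier

variable {d : ℕ} {M : Matrix (Fin d) (Fin d) ℤ} {D : DigitSet M} {Ds : DigitSet M.transpose}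

/-- The inverse Fourier transform of an integrable function on `V*`. -/
noncomputable def invFourier (D : DigitSet M) (g : Vilenkin Ds → ℂ) (x : Vilenkin D) : ℂ :=
  ∫ ω, g ω * chi x ω ∂(haar Ds)

theorem invFourier_add_of_mem_U {g : Vilenkin Ds → ℂ} {q : ℤ}
    (hs : Function.support g ⊆ U Ds (-q)) (x : Vilenkin D) {u : Vilenkin D} (hu : u ∈ U D q) :
    invFourier D g (x + u) = invFourier D g x := by
  refine integral_congr_ae (Eventually.of_forall fun ω => ?_)
  by_cases h : ω ∈ U Ds (-q)
  · simp only [chi_add_left, chi_eq_one_of_mem_U hu h (by omega), mul_one]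
  · simp only [Function.notMem_support.1 fun h' => h (hs h'), zero_mul]

/-- Translating the integral by $u\in U^*_p$ multiplies it by $\chi(x,u)$, and outside $U_{-p}$ some
such factor is not $1$. -/
theorem support_invFourier_subset {g : Vilenkin Ds → ℂ} {p : ℤ}
    (hp : ∀ ω, ∀ u ∈ U Ds p, g (ω + u) = g ω) :
    Function.support (invFourier D g) ⊆ U D (-p) := by
  intro x hx
  by_contra h
  obtain ⟨u, hu, hne⟩ := exists_chi_ne_one_left (Ds := Ds) h
  have h1 := integral_add_right_eq_self (μ := haar Ds) (fun ω => g ω * chi x ω) u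
  have h2 : ∀ ω, g (ω + u) * chi x (ω + u) = chi x u * (g ω * chi x ω) := fun ω => by
    rw [hp ω u hu, chi_add_right]; ring
  simp only [h2, integral_const_mul] at h1
  exact hne (mul_right_cancel₀ hx (by rw [one_mul]; exact h1))

theorem continuous_of_invariant {E : DigitSet M} {f : Vilenkin E → ℂ} {p : ℤ}
    (hp : ∀ x, ∀ u ∈ U E p, f (x + u) = f x) : Continuous f :=
  continuous_of_locally_invariant fun x => ⟨p, hp x⟩

theorem integrable_of_invariant {E : DigitSet M} {f : Vilenkin E → ℂ} {p q : ℤ}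
    (hp : ∀ x, ∀ u ∈ U E p, f (x + u) = f x) (hs : Function.support f ⊆ U E q) :
    Integrable f (haar E) :=
  (continuous_of_invariant hp).integrable_of_hasCompactSupport (hasCompactSupport_of_subset_U hs)

theorem memLp_of_invariant {E : DigitSet M} {f : Vilenkin E → ℂ} {p q : ℤ}
    (hp : ∀ x, ∀ u ∈ U E p, f (x + u) = f x) (hs : Function.support f ⊆ U E q) :
    MemLp f 2 (haar E) :=
  (continuous_of_invariant hp).memLp_of_hasCompactSupport (hasCompactSupport_of_subset_U hs)

/-- As the inverse transform vanishes off $U_{-p}$, the outer integral may be cut to that set, which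
legitimises Fubini. The resulting kernel is $\mu(U_{-p})$ times the indicator of $\omega\oplus
U^*_p$, on which $g$ is constant. -/
theorem fourier_invFourier {g : Vilenkin Ds → ℂ} {p : ℕ} (hg : Integrable g (haar Ds))
    (hp : ∀ ω, ∀ u ∈ U Ds p, g (ω + u) = g ω) (ω : Vilenkin Ds) :
    fourier Ds (invFourier D g) ω = g ω := by
  have hF : Integrable ((U D (-p)).indicator fun x : Vilenkin D => conj (chi x ω)) (haar D) := by
    rw [integrable_indicator_iff (measurableSet_U _)]
    exact (Complex.continuous_conj.comp (continuous_chi_left ω)).continuousOn.integrableOn_compact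
      (isCompact_U _)
  have h1 : fourier Ds (invFourier D g) ω = ∫ x, (U D (-p)).indicator
      (fun x : Vilenkin D => conj (chi x ω)) x * ∫ ν, g ν * chi x ν ∂(haar Ds) ∂(haar D) := by
    refine integral_congr_ae (Eventually.of_forall fun x => ?_)
    by_cases hx : x ∈ U D (-p)
    · simp only [Set.indicator_of_mem hx, invFourier]
      ring
    · simp only [Set.indicator_of_notMem hx,
        Function.notMem_support.1 fun h' => hx (support_invFourier_subset hp h'), zero_mul]
  rw [h1, integral_mul_integral_chi hF hg]
  have h2 : ∀ ν : Vilenkin Ds, g ν * ∫ x, (U D (-p)).indicator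
      (fun x : Vilenkin D => conj (chi x ω)) x * chi x ν ∂(haar D)
      = {ν | ν - ω ∈ U Ds p}.indicator
        (fun _ => g ω * ((haar D).real (U D (-p)) : ℂ)) ν := by
    intro ν
    have h3 : ∫ x, (U D (-p)).indicator (fun x : Vilenkin D => conj (chi x ω)) x * chi x ν ∂(haar D)
        = ∫ x in U D (-p), chi x (ν - ω) ∂(haar D) := by
      rw [← integral_indicator (measurableSet_U _)]
      refine integral_congr_ae (Eventually.of_forall fun x => ?_)
      by_cases hx : x ∈ U D (-p)
      · simp only [Set.indicator_of_mem hx, chi_sub_right]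
        ring
      · simp only [Set.indicator_of_notMem hx, zero_mul]
    rw [h3, setIntegral_chi_left, neg_neg]
    by_cases hν : ν - ω ∈ U Ds p
    · rw [Set.indicator_of_mem hν, Set.indicator_of_mem (s := {ν | ν - ω ∈ U Ds p}) hν]
      have := hp ω _ hν
      rw [add_sub_cancel] at this
      rw [this]
    · rw [Set.indicator_of_notMem hν, Set.indicator_of_notMem (s := {ν | ν - ω ∈ U Ds p}) hν,
        mul_zero]
  simp only [h2]
  rw [integral_indicator (measurableSet_coset ω p), setIntegral_const, Measure.real, haar_coset,
    ← Measure.real, Complex.real_smul, mul_left_comm, ← Complex.ofReal_mul, mul_comm ((haar Ds).real _),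
    haar_real_U_mul, Complex.ofReal_one, mul_one]

/-- The integrals of `f` over the cosets of the `U_l` in terms of its Fourier transform. -/
theorem setIntegral_coset_of_integrable {f : Vilenkin D → ℂ} (hf : Integrable f (haar D))
    (x : Vilenkin D) (l : ℤ) :
    (∫ y in {y | y - x ∈ U D l}, f y ∂(haar D)) * ((haar Ds).real (U Ds (-l)) : ℂ)
      = ∫ ω in U Ds (-l), chi x ω * fourier Ds f ω ∂(haar Ds) := by
  have hG : Integrable ((U Ds (-l)).indicator fun ω : Vilenkin Ds => chi x ω) (haar Ds) := by
    rw [integrable_indicator_iff (measurableSet_U _)]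
    exact (continuous_chi_right x).continuousOn.integrableOn_compact (isCompact_U _)
  have h := integral_mul_integral_conj_chi hf hG
  -- The transform of $\mathbf 1_{U^*_{-l}}\chi(x,\cdot)$ is a multiple of the indicator of $x\oplus
  -- U_l$; this is why it is the right test function.
  have hL : ∀ y : Vilenkin D, f y * ∫ ω, (U Ds (-l)).indicator (fun ω => chi x ω) ω *
      conj (chi y ω) ∂(haar Ds)
      = {y | y - x ∈ U D l}.indicator (fun y => f y * ((haar Ds).real (U Ds (-l)) : ℂ)) y := by
    intro y
    have h3 : ∫ ω, (U Ds (-l)).indicator (fun ω => chi x ω) ω * conj (chi y ω) ∂(haar Ds)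
        = ∫ ω in U Ds (-l), chi (x - y) ω ∂(haar Ds) := by
      rw [← integral_indicator (measurableSet_U _)]
      refine integral_congr_ae (Eventually.of_forall fun ω => ?_)
      by_cases hω : ω ∈ U Ds (-l)
      · simp only [Set.indicator_of_mem hω, chi_sub_left]
      · simp only [Set.indicator_of_notMem hω, zero_mul]
    have hmem : x - y ∈ U D l ↔ y - x ∈ U D l :=
      ⟨fun h => by simpa using neg_mem_U h, fun h => by simpa using neg_mem_U h⟩
    rw [h3, setIntegral_chi_right, neg_neg]
    by_cases hy : y - x ∈ U D l
    · rw [Set.indicator_of_mem (hmem.2 hy), Set.indicator_of_mem (s := {y | y - x ∈ U D l}) hy]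
    · rw [Set.indicator_of_notMem (fun h => hy (hmem.1 h)),
        Set.indicator_of_notMem (s := {y | y - x ∈ U D l}) hy, mul_zero]
  simp only [hL] at h
  rw [integral_indicator (measurableSet_coset x l), integral_mul_const] at h
  rw [h, ← integral_indicator (measurableSet_U _)]
  refine integral_congr_ae (Eventually.of_forall fun ω => ?_)
  by_cases hω : ω ∈ U Ds (-l)
  · simp only [Set.indicator_of_mem hω]
  · simp only [Set.indicator_of_notMem hω, zero_mul]

/-- The integrable case passes to the limit: the left side is an inner product with an indicator,
and on the finite measure set $U^*_{-l}$ convergence in $L_2$ implies convergence in $L_1$. -/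
theorem setIntegral_coset_of_isFourierL2 {φ : L2 D} {g : Vilenkin Ds → ℂ} (h : IsFourierL2 φ g)
    (x : Vilenkin D) (l : ℤ) :
    (∫ y in {y | y - x ∈ U D l}, φ y ∂(haar D)) * ((haar Ds).real (U Ds (-l)) : ℂ)
      = ∫ ω in U Ds (-l), chi x ω * g ω ∂(haar Ds) := by
  obtain ⟨hg, u, hu, hlim, hF⟩ := h
  have hfin : haar D {y | y - x ∈ U D l} ≠ ∞ := by rw [haar_coset]; exact haar_U_ne_top l
  have h1 : Tendsto (fun k => ∫ y in {y | y - x ∈ U D l}, u k y ∂(haar D)) atTop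
      (𝓝 (∫ y in {y | y - x ∈ U D l}, φ y ∂(haar D))) := by
    simp only [← L2.inner_indicatorConstLp_one (𝕜 := ℂ) (measurableSet_coset x l) hfin]
    exact tendsto_const_nhds.inner hlim
  have hmeas : ∀ k, AEStronglyMeasurable (fun ω => fourier Ds (u k) ω - g ω) (haar Ds) := fun k =>
    (continuous_fourier (hu k)).aestronglyMeasurable.sub hg.aestronglyMeasurable
  have : IsFiniteMeasure ((haar Ds).restrict (U Ds (-l))) :=
    ⟨by rw [Measure.restrict_apply_univ]; exact (haar_U_ne_top _).lt_top⟩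
  have hchi : AEStronglyMeasurable (fun ω : Vilenkin Ds => chi x ω)
      ((haar Ds).restrict (U Ds (-l))) := (continuous_chi_right x).aestronglyMeasurable
  have h2 : Tendsto (fun k => ∫ ω in U Ds (-l), chi x ω * fourier Ds (u k) ω ∂(haar Ds)) atTop
      (𝓝 (∫ ω in U Ds (-l), chi x ω * g ω ∂(haar Ds))) := by
    have hgi : Integrable g ((haar Ds).restrict (U Ds (-l))) :=
      (hg.restrict _).integrable (by norm_num)
    refine tendsto_integral_of_L1' _ (hgi.bdd_mul hchi (c := 1)
      (Eventually.of_forall fun ω => (norm_chi x ω).le)).aestronglyMeasurable (Eventually.of_forall fun k => ?_) ?_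
    · exact ((continuous_chi_right x).mul (continuous_fourier (hu k))).continuousOn.integrableOn_compact
        (isCompact_U _)
    · have hle : ∀ k, eLpNorm ((fun ω => chi x ω * fourier Ds (u k) ω) - fun ω => chi x ω * g ω) 1
          ((haar Ds).restrict (U Ds (-l)))
          ≤ eLpNorm (fun ω => fourier Ds (u k) ω - g ω) 2 (haar Ds) *
            ((haar Ds).restrict (U Ds (-l))) Set.univ ^ (1 / (1 : ℝ≥0∞).toReal - 1 / (2 : ℝ≥0∞).toReal) := by
        intro k
        have e1 : eLpNorm ((fun ω => chi x ω * fourier Ds (u k) ω) - fun ω => chi x ω * g ω) 1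
            ((haar Ds).restrict (U Ds (-l)))
            = eLpNorm (fun ω => fourier Ds (u k) ω - g ω) 1 ((haar Ds).restrict (U Ds (-l))) := by
          refine eLpNorm_congr_norm_ae (Eventually.of_forall fun ω => ?_)
          simp only [Pi.sub_apply]
          rw [← mul_sub, norm_mul, norm_chi, one_mul]
        rw [e1]
        refine (eLpNorm_le_eLpNorm_mul_rpow_measure_univ (q := 2) (by norm_num) (hmeas k).restrict).trans ?_
        gcongr
        exact Measure.restrict_le_self
      refine tendsto_of_tendsto_of_tendsto_of_le_of_le tendsto_const_nhds ?_ (fun _ => zero_le) hle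
      have hC : ((haar Ds).restrict (U Ds (-l))) Set.univ ^
          (1 / (1 : ℝ≥0∞).toReal - 1 / (2 : ℝ≥0∞).toReal) ≠ ∞ :=
        ENNReal.rpow_ne_top_of_nonneg (by norm_num) (measure_ne_top _ _)
      simpa using ENNReal.Tendsto.mul_const hF (Or.inr hC)
  refine tendsto_nhds_unique (h1.mul_const _) ?_
  simpa only [setIntegral_coset_of_integrable (hu _)] using h2

theorem IsFourierL2.unique {φ ψ : L2 D} {g : Vilenkin Ds → ℂ} (hφ : IsFourierL2 φ g)
    (hψ : IsFourierL2 ψ g) : φ = ψ := by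
  rw [← sub_eq_zero, Lp.eq_zero_iff_ae_eq_zero]
  have hint : ∀ (χ : L2 D) (s : Set (Vilenkin D)), haar D s ≠ ∞ → IntegrableOn χ s (haar D) :=
    fun χ s hs => integrableOn_Lp_of_measure_ne_top χ (by norm_num) hs
  refine ae_eq_zero_of_setIntegral_coset_eq_zero (fun l => hint _ _ (haar_U_ne_top l)) fun x l => ?_
  have hfin : haar D {y | y - x ∈ U D l} ≠ ∞ := by rw [haar_coset]; exact haar_U_ne_top l
  rw [integral_congr_ae (ae_restrict_of_ae (Lp.coeFn_sub φ ψ))]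
  simp only [Pi.sub_apply]
  rw [integral_sub (hint _ _ hfin) (hint _ _ hfin), sub_eq_zero]
  have hne : ((haar Ds).real (U Ds (-l)) : ℂ) ≠ 0 := by
    exact_mod_cast (haar_real_U_pos (D := Ds) (-l)).ne'
  refine mul_right_cancel₀ hne ?_
  rw [setIntegral_coset_of_isFourierL2 hφ, setIntegral_coset_of_isFourierL2 hψ]

end InverseFourier

/-! ### Masks are Walsh polynomials. -/

section Walsh

variable {d : ℕ} {M : Matrix (Fin d) (Fin d) ℤ} {D : DigitSet M} {Ds : DigitSet M.transpose}

/-- The element of `V` with the coordinates `w_0, …, w_{n-1}` at the places `1, …, n`. -/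
noncomputable def ofWord {n : ℕ} (w : Fin n → Digit Ds) : Vilenkin Ds :=
  ⟨fun j => if h : 1 ≤ j ∧ j ≤ n then w ⟨(j - 1).toNat, by omega⟩ else 0,
    1, fun j hj => dif_neg (by omega)⟩

theorem ofWord_apply {n : ℕ} (w : Fin n → Digit Ds) (j : ℤ) : (ofWord w) j =
    if h : 1 ≤ j ∧ j ≤ n then w ⟨(j - 1).toNat, by omega⟩ else 0 := rfl

theorem ofWord_add {n : ℕ} (w w' : Fin n → Digit Ds) :
    ofWord (w + w') = ofWord w + ofWord w' := by
  refine vilenkin_ext fun j => ?_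
  rw [coe_add, ofWord_apply, ofWord_apply, ofWord_apply]
  split_ifs
  · rfl
  · rw [add_zero]

theorem ofWord_zero {n : ℕ} : ofWord (0 : Fin n → Digit Ds) = 0 := by
  refine vilenkin_ext fun j => ?_
  rw [ofWord_apply]
  split_ifs <;> rfl

theorem gam_mem_U {k n : ℕ} (hk : k < M.det.natAbs ^ n) : gam D k ∈ U D (-n) := by
  intro j hj
  change (if 0 < j then 0 else D.nthDigit (k / M.det.natAbs ^ (-j).toNat)) = 0
  split_ifs with h
  · rfl
  · rw [Nat.div_eq_of_lt (hk.trans_le (Nat.pow_le_pow_right D.m_pos (by omega))),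
      D.nthDigit_zero]

theorem gam_mem_H (k : ℕ) : gam D k ∈ H D := fun _ hj => if_pos hj

theorem nthDigit_inj {k k' : ℕ} (h : D.nthDigit k = D.nthDigit k') :
    k % M.det.natAbs = k' % M.det.natAbs := by
  have h1 := congrArg Subtype.val h
  by_contra hne
  refine D.incongruent ⟨k % M.det.natAbs, Nat.mod_lt _ D.m_pos⟩
    ⟨k' % M.det.natAbs, Nat.mod_lt _ D.m_pos⟩ (fun h' => hne (congrArg Fin.val h')) ⟨0, ?_⟩
  rw [Matrix.mulVec_zero, sub_eq_zero]
  exact h1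

theorem gam_injOn {n k k' : ℕ} (hk : k < M.det.natAbs ^ n) (hk' : k' < M.det.natAbs ^ n)
    (h : gam D k = gam D k') : k = k' := by
  have hd : ∀ i : ℕ, k / M.det.natAbs ^ i % M.det.natAbs = k' / M.det.natAbs ^ i % M.det.natAbs := by
    intro i
    have h1 : (gam D k) (-(i : ℤ)) = (gam D k') (-(i : ℤ)) := by rw [h]
    have h2 : ∀ q, (gam D q) (-(i : ℤ)) = D.nthDigit (q / M.det.natAbs ^ i) := by
      intro q
      change (if 0 < -(i : ℤ) then 0 else D.nthDigit (q / M.det.natAbs ^ (- -(i : ℤ)).toNat)) = _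
      rw [if_neg (by omega), neg_neg, Int.toNat_natCast]
    rw [h2, h2] at h1
    exact nthDigit_inj h1
  clear h
  induction n generalizing k k' with
  | zero => simp at hk hk'; omega
  | succ n ih =>
    have h0 : k % M.det.natAbs = k' % M.det.natAbs := by simpa using hd 0
    have h1 : k / M.det.natAbs = k' / M.det.natAbs := by
      refine ih (Nat.div_lt_of_lt_mul (by rwa [pow_succ'] at hk))
        (Nat.div_lt_of_lt_mul (by rwa [pow_succ'] at hk')) fun i => ?_
      have := hd (i + 1)
      rwa [pow_succ', ← Nat.div_div_eq_div_mul, ← Nat.div_div_eq_div_mul] at this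
    rw [← Nat.div_add_mod k M.det.natAbs, ← Nat.div_add_mod k' M.det.natAbs, h0, h1]

/-- Walsh functions of order `n` depend on the first `n` digits after the point only. -/
theorem chi_ofWord {n : ℕ} {x : Vilenkin D} (hx : x ∈ H D) (hxn : x ∈ U D (-n))
    (ω : Vilenkin Ds) : chi x (ofWord (word n ω 1)) = chi x ω := by
  have h : chi x (ω - ofWord (word n ω 1)) = 1 := by
    refine chi_eq_one fun j => ?_
    rcases le_or_gt j (-n) with h | h
    · exact Or.inl (hxn j h)
    · rcases lt_or_ge 0 j with h' | h'
      · exact Or.inl (hx j h')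
      · right
        rw [coe_sub, ofWord_apply, dif_pos ⟨by omega, by omega⟩, sub_eq_zero]
        exact congrArg ω.1 (by simp only; omega)
  conv_rhs => rw [← sub_add_cancel ω (ofWord (word n ω 1)), chi_add_right, h, one_mul]

/-- The character of the group of words of length `n` defined by `x ∈ V`. -/
noncomputable def wordChar (Ds : DigitSet M.transpose) (n : ℕ) (x : Vilenkin D) :
    AddChar (Fin n → Digit Ds) ℂ where
  toFun w := chi x (ofWord w)
  map_zero_eq_one' := by rw [ofWord_zero, chi_zero_right]
  map_add_eq_mul' w w' := by rw [ofWord_add, chi_add_right]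

/-- Distinct $\gamma_{[k]}$ are separated by some $u\in V^*$, and only the first $n$ digits of $u$
after the point matter for them. -/
theorem wordChar_gam_injective (n : ℕ) : Function.Injective
    fun k : Fin (M.det.natAbs ^ n) => wordChar Ds n (gam D k) := by
  intro k k' h
  apply Fin.ext
  refine gam_injOn (D := D) k.2 k'.2 ?_
  by_contra hne
  rw [← sub_eq_zero] at hne
  obtain ⟨j, hj⟩ : ∃ j, (gam D k - gam D k') j ≠ 0 := by
    by_contra! hall
    exact hne (vilenkin_ext hall)
  have hnot : gam D k - gam D k' ∉ U D (-(-j)) := fun hu => hj (hu j (by omega))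
  obtain ⟨u, -, hne1⟩ := exists_chi_ne_one_left (Ds := Ds) hnot
  apply hne1
  have h1 := DFunLike.congr_fun h (word n u 1)
  change chi (gam D k) _ = chi (gam D k') _ at h1
  rw [chi_ofWord (gam_mem_H _) (gam_mem_U k.2), chi_ofWord (gam_mem_H _) (gam_mem_U k'.2)] at h1
  rw [chi_sub_left, h1, mul_comm, conj_chi_mul_self]

/-- The Walsh functions give $m^n$ distinct characters of a group of order $m^n$. Characters are
linearly independent, so these form a basis of all functions of a word. -/
theorem isWalshPolynomial_mask {n : ℕ} (b : (Fin n → Digit Ds) → ℂ) :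
    IsWalshPolynomial D Ds n (mask b) := by
  have : Fintype (Digit Ds) := Fintype.ofFinite _
  have hli : LinearIndependent ℂ fun k : Fin (M.det.natAbs ^ n) =>
      (wordChar Ds n (gam D k) : (Fin n → Digit Ds) → ℂ) :=
    (AddChar.linearIndependent (Fin n → Digit Ds) ℂ).comp _ (wordChar_gam_injective n)
  have hcard : Fintype.card (Fin (M.det.natAbs ^ n))
      = Module.finrank ℂ ((Fin n → Digit Ds) → ℂ) := by
    rw [Module.finrank_fintype_fun_eq_card, Fintype.card_fin, Fintype.card_fun, Fintype.card_fin,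
      ← Nat.card_eq_fintype_card, card_digit, Matrix.det_transpose]
  have hspan := hli.span_eq_top_of_card_eq_finrank' hcard
  have hb : b ∈ Submodule.span ℂ (Set.range fun k : Fin (M.det.natAbs ^ n) =>
      (wordChar Ds n (gam D k) : (Fin n → Digit Ds) → ℂ)) := by
    rw [hspan]; trivial
  rw [Submodule.mem_span_range_iff_exists_fun] at hb
  obtain ⟨c, hc⟩ := hb
  refine ⟨fun k => if h : k < M.det.natAbs ^ n then c ⟨k, h⟩ else 0, fun ω => ?_⟩
  rw [← Fin.sum_univ_eq_sum_range (fun k => (if h : k < M.det.natAbs ^ n then c ⟨k, h⟩ else 0) *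
    chi (gam D k) ω), mask, ← hc, Finset.sum_apply]
  refine Finset.sum_congr rfl fun k _ => ?_
  rw [dif_pos k.2, Pi.smul_apply, smul_eq_mul]
  congr 1
  exact chi_ofWord (gam_mem_H _) (gam_mem_U k.2) ω

end Walsh

/-! ### The refinement equation. -/

section Refinable

variable {d : ℕ} {M : Matrix (Fin d) (Fin d) ℤ} {D : DigitSet M} {Ds : DigitSet M.transpose}

/-- Uniqueness of Haar measure. The value of $c$ is not needed: it is absorbed into the refinement
coefficients. -/
theorem exists_map_dil_haar (E : DigitSet M) (k : ℤ) :
    ∃ c : NNReal, Measure.map (dil k) (haar E) = c • haar E := by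
  have := (dilEquiv E k).isAddHaarMeasure_map (haar E) (continuous_dil k) (continuous_dil (-k))
  exact ⟨_, Measure.isAddLeftInvariant_eq_smul (Measure.map (dilEquiv E k) (haar E)) (haar E)⟩

theorem quasiMeasurePreserving_dil (E : DigitSet M) (k : ℤ) :
    Measure.QuasiMeasurePreserving (dil k) (haar E) (haar E) := by
  obtain ⟨c, hc⟩ := exists_map_dil_haar E k
  exact ⟨(continuous_dil k).measurable, hc ▸ Measure.smul_absolutelyContinuous⟩

theorem ae_eq_comp_dil_add {E : DigitSet M} {φ f : Vilenkin E → ℂ} (h : φ =ᵐ[haar E] f) (k : ℤ)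
    (y : Vilenkin E) : ∀ᵐ x ∂(haar E), φ (dil k x + y) = f (dil k x + y) := by
  have h1 : ∀ᵐ x ∂(haar E), φ (x + y) = f (x + y) :=
    (measurePreserving_add_right (haar E) y).quasiMeasurePreserving.ae (p := fun z => φ z = f z) h
  exact (quasiMeasurePreserving_dil E k).ae (p := fun z => φ (z + y) = f (z + y)) h1

theorem exists_integral_dil (E : DigitSet M) (k : ℤ) :
    ∃ c : ℂ, ∀ f : Vilenkin E → ℂ, ∫ x, f (dil k x) ∂(haar E) = c * ∫ x, f x ∂(haar E) := by
  obtain ⟨c, hc⟩ := exists_map_dil_haar E k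
  let e : Vilenkin E ≃ᵐ Vilenkin E :=
    { toEquiv := (dilEquiv E k).toEquiv
      measurable_toFun := (continuous_dil k).measurable
      measurable_invFun := (continuous_dil (-k)).measurable }
  refine ⟨((c : ℝ) : ℂ), fun f => ?_⟩
  have h1 : ∫ x, f x ∂(Measure.map (dil k) (haar E)) = ∫ x, f (dil k x) ∂(haar E) :=
    integral_map_equiv e f
  rw [← h1, hc, integral_smul_nnreal_measure]
  rfl

/-- The inverse Fourier transform of a solution of the refinement equation in the frequency domain
satisfies the refinement equation. -/
theorem exists_refinement_coefficients {n : ℕ} {g m₀ : Vilenkin Ds → ℂ} (hg : Integrable g (haar Ds))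
    (hm₀ : IsWalshPolynomial D Ds n m₀) (hrec : ∀ ω, g ω = m₀ (dil (-1) ω) * g (dil (-1) ω)) :
    ∃ α : ℕ → ℂ, ∀ x, HasSum (fun k => α k * invFourier D g (dil 1 x + gam D k))
      (invFourier D g x) := by
  obtain ⟨β, hβ⟩ := hm₀
  obtain ⟨c, hc⟩ := exists_integral_dil Ds (-1)
  have hint : ∀ x : Vilenkin D, Integrable (fun ω => g ω * chi x ω) (haar Ds) := fun x =>
    hg.mul_bdd (c := 1) (continuous_chi_right x).aestronglyMeasurable
      (Eventually.of_forall fun ω => (norm_chi x ω).le)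
  refine ⟨fun k => if k < M.det.natAbs ^ n then c * β k else 0, fun x => ?_⟩
  have hsum : invFourier D g x = ∑ k ∈ Finset.range (M.det.natAbs ^ n),
      (if k < M.det.natAbs ^ n then c * β k else 0) * invFourier D g (dil 1 x + gam D k) := by
    have h1 : invFourier D g x = ∫ ω, (fun ν => ∑ k ∈ Finset.range (M.det.natAbs ^ n),
        β k * (g ν * chi (dil 1 x + gam D k) ν)) (dil (-1) ω) ∂(haar Ds) := by
      refine integral_congr_ae (Eventually.of_forall fun ω => ?_)
      simp only
      -- Since $\chi(x,\omega)=\chi(\mathcal Mx,\mathcal M^{*-1}\omega)$, the integrand is a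
      -- function of $\mathcal M^{*-1}\omega$ alone, and each Walsh function becomes a shift of the
      -- argument by $\gamma_{[k]}$.
      rw [hrec ω, hβ, ← chi_dil 1 x ω, Finset.sum_mul, Finset.sum_mul]
      refine Finset.sum_congr rfl fun k _ => ?_
      rw [chi_add_left]
      ring
    rw [h1, hc fun ν => ∑ k ∈ Finset.range (M.det.natAbs ^ n),
      β k * (g ν * chi (dil 1 x + gam D k) ν), integral_finsetSum _ fun k _ => (hint _).const_mul _, Finset.mul_sum]
    refine Finset.sum_congr rfl fun k hk => ?_
    rw [if_pos (Finset.mem_range.1 hk), integral_const_mul, mul_assoc]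
    rfl
  rw [hsum]
  refine hasSum_sum_of_ne_finset_zero fun k hk => ?_
  simp only [if_neg (show ¬ k < M.det.natAbs ^ n by simpa using hk), zero_mul]

end Refinable

/-! ### Orthonormality of the translates. -/

section Orthogonality

variable {d : ℕ} {M : Matrix (Fin d) (Fin d) ℤ} {D : DigitSet M} {Ds : DigitSet M.transpose}

theorem fourier_comp_add (f : Vilenkin D → ℂ) (h : Vilenkin D) (ω : Vilenkin Ds) :
    fourier Ds (fun x => f (x + h)) ω = chi h ω * fourier Ds f ω := by
  rw [fourier, fourier, ← integral_add_right_eq_self (μ := haar D) (fun x => f x * conj (chi x ω)) h,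
    ← integral_const_mul]
  refine integral_congr_ae (Eventually.of_forall fun x => ?_)
  simp only [chi_add_left, map_mul]
  have := conj_chi_mul_self h ω
  linear_combination (-(f (x + h) * conj (chi x ω))) * this

/-- Plancherel's formula for translates of inverse Fourier transforms. -/
theorem integral_conj_translate_mul_translate {g : Vilenkin Ds → ℂ} (hg : Integrable g (haar Ds))
    (hf : Integrable (invFourier D g) (haar D))
    (hfg : ∀ ω, fourier Ds (invFourier D g) ω = g ω) (h h' : Vilenkin D) :
    ∫ x, conj (invFourier D g (x + h)) * invFourier D g (x + h') ∂(haar D)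
      = ∫ ω, conj (g ω) * g ω * chi (h' - h) ω ∂(haar Ds) := by
  have hG : Integrable (fun ω => g ω * chi h' ω) (haar Ds) :=
    hg.mul_bdd (c := 1) (continuous_chi_right h').aestronglyMeasurable
      (Eventually.of_forall fun ω => (norm_chi h' ω).le)
  have hF : Integrable (fun x => conj (invFourier D g (x + h))) (haar D) :=
    (Complex.conjLIE.toContinuousLinearEquiv.toContinuousLinearMap).integrable_comp
      (hf.comp_add_right h)
  have h1 := integral_mul_integral_chi hF hG
  have h2 : ∀ x : Vilenkin D, ∫ ω, g ω * chi h' ω * chi x ω ∂(haar Ds)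
      = invFourier D g (x + h') := fun x => by
    refine integral_congr_ae (Eventually.of_forall fun ω => ?_)
    simp only [chi_add_left]
    ring
  have h3 : ∀ ω : Vilenkin Ds, ∫ x, conj (invFourier D g (x + h)) * chi x ω ∂(haar D)
      = conj (chi h ω * g ω) := fun ω => by
    rw [← hfg ω, ← fourier_comp_add, fourier, ← integral_conj]
    simp only [map_mul, Complex.conj_conj]
  simp only [h2, h3] at h1
  rw [h1]
  refine integral_congr_ae (Eventually.of_forall fun ω => ?_)
  simp only [map_mul, chi_sub_left]
  ring

/-- Each difference in `conj_maskProd_mul_self` becomes $F_k(\omega)-F_k(\omega\oplus\eta)$ with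
$\eta\in H^*$, because $\chi(h,\eta)=1$; by invariance of the measure its integral is zero. -/
theorem integral_conj_maskProd_mul_self_mul_chi {n r : ℕ} (hn : 2 ≤ n) (hr : n ≤ r)
    {ξ : Fin (r + 1) → Digit Ds} (hξ : ∀ i, ξ i ≠ 0) (hw : DistinctWindows n ξ)
    {b : (Fin n → Digit Ds) → ℂ} (hb : IsAssociatedMask ξ b) {h : Vilenkin D} (hh : h ∈ H D) :
    ∫ ω, conj (maskProd b ω) * maskProd b ω * chi h ω ∂(haar Ds)
      = ∫ ω in U Ds 0, chi h ω ∂(haar Ds) := by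
  have hi : ∀ s : Set (Vilenkin Ds), MeasurableSet s → haar Ds s ≠ ∞ →
      Integrable (fun ω => s.indicator (fun _ => (1 : ℂ)) ω * chi h ω) (haar Ds) := fun s hs hs' =>
    ((integrable_indicator_iff hs).2 (integrableOn_const hs')).mul_bdd (c := 1)
      (continuous_chi_right h).aestronglyMeasurable
      (Eventually.of_forall fun ω => (norm_chi h ω).le)
  let F : ℕ → Vilenkin Ds → ℂ := fun k ω =>
    {y | y - chainPoint n ξ k ∈ U Ds ((n : ℤ) - 1)}.indicator (fun _ => (1 : ℂ)) ω * chi h ω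
  have hF : ∀ k, Integrable (F k) (haar Ds) := fun k =>
    hi _ (measurableSet_coset _ _) (by rw [haar_coset]; exact haar_U_ne_top _)
  have hF' : ∀ k, Integrable (fun ω => F k (ω + chainInt n ξ k)) (haar Ds) := fun k =>
    (hF k).comp_add_right _
  have hsum : Integrable (fun ω => ∑ k ∈ Finset.Icc 1 (r - n + 2),
      (F k ω - F k (ω + chainInt n ξ k))) (haar Ds) :=
    integrable_finsetSum _ fun k _ => (hF k).sub (hF' k)
  have hdecomp : ∀ ω, conj (maskProd b ω) * maskProd b ω * chi h ω
      = (U Ds 0).indicator (fun _ => (1 : ℂ)) ω * chi h ω +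
        ∑ k ∈ Finset.Icc 1 (r - n + 2), (F k ω - F k (ω + chainInt n ξ k)) := by
    intro ω
    simp only [conj_maskProd_mul_self hn hξ hw hb hr, add_mul, Finset.sum_mul, sub_mul, F,
      chi_add_right, chi_eq_one_of_mem_H hh (chainInt_mem_H _), mul_one]
  simp only [hdecomp]
  rw [integral_add (hi _ (measurableSet_U 0) (haar_U_ne_top 0)) hsum,
    integral_finsetSum (f := fun k ω => F k ω - F k (ω + chainInt n ξ k)) _
      fun k _ => (hF k).sub (hF' k), Finset.sum_eq_zero, add_zero,
    ← integral_indicator (measurableSet_U 0)]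
  · refine integral_congr_ae (Eventually.of_forall fun ω => ?_)
    by_cases hω : ω ∈ U Ds 0
    · simp [Set.indicator_of_mem hω]
    · simp [Set.indicator_of_notMem hω]
  · intro k _
    rw [integral_sub (hF k) (hF' k), integral_add_right_eq_self (F k), sub_self]

theorem translate_ae_eq {φ : L2 D} {f : Vilenkin D → ℂ} (h : φ =ᵐ[haar D] f) (y : Vilenkin D) :
    translate φ y =ᵐ[haar D] fun x => f (x + y) :=
  (Lp.coeFn_compMeasurePreserving φ (measurePreserving_add_right (haar D) y)).trans
    ((measurePreserving_add_right (haar D) y).quasiMeasurePreserving.ae_eq_comp h)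

/-- Elements of $H$ vanish at positive places, so $h'\ominus h\in U$ only if $h=h'$: the indicator
is a Kronecker delta. -/
theorem orthonormal_translate {φ : L2 D} {f : Vilenkin D → ℂ} (hφ : φ =ᵐ[haar D] f)
    (hf : ∀ h ∈ H D, ∀ h' ∈ H D, ∫ x, conj (f (x + h)) * f (x + h') ∂(haar D)
      = (U D 0).indicator (fun _ => (1 : ℂ)) (h' - h)) :
    Orthonormal ℂ (fun h : H D => translate φ h.1) := by
  classical
  rw [orthonormal_iff_ite]
  rintro ⟨h, hh⟩ ⟨h', hh'⟩
  rw [L2.inner_def]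
  have h1 : ∫ x, inner ℂ (translate φ h x) (translate φ h' x) ∂(haar D)
      = ∫ x, conj (f (x + h)) * f (x + h') ∂(haar D) := by
    refine integral_congr_ae ?_
    filter_upwards [translate_ae_eq hφ h, translate_ae_eq hφ h'] with x hx hx'
    rw [hx, hx', RCLike.inner_apply, mul_comm]
  rw [h1, hf h hh h' hh', Set.indicator_apply]
  refine if_congr ?_ rfl rfl
  rw [sub_mem_U_iff, Subtype.mk_eq_mk]
  refine ⟨fun H => vilenkin_ext fun j => ?_, fun H j _ => by rw [H]⟩
  rcases le_or_gt j 0 with hj | hj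
  · exact (H j hj).symm
  · rw [hh j hj, hh' j hj]

end Orthogonality

/-! ### Test functions and the assembly of the theorem. -/

theorem mem_testFun {d : ℕ} {M : Matrix (Fin d) (Fin d) ℤ} {D : DigitSet M} {f : Vilenkin D → ℂ}
    {l k : ℤ} (hl : ∀ x, ∀ u ∈ U D l, f (x + u) = f x) (hk : Function.support f ⊆ U D (-k)) :
    f ∈ TestFun D l k := by
  refine ⟨?_, by rwa [image_dil_U, zero_sub]⟩
  intro i x hx x' hx'
  rw [Unk, image_dil_U, zero_sub, neg_neg] at hx hx'
  obtain ⟨_, rfl, u, hu, rfl⟩ := hx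
  obtain ⟨_, rfl, u', hu', rfl⟩ := hx'
  simp only [hl _ _ hu, hl _ _ hu']

end GenVilenkin

theorem theorem7 {d : ℕ} {M : Matrix (Fin d) (Fin d) ℤ} (hM : GenVilenkin.IsDilation M)
    (D : GenVilenkin.DigitSet M) (Ds : GenVilenkin.DigitSet M.transpose)
    (n r : ℕ) (hn : 2 ≤ n) (hr : n ≤ r)
    (ξ : Fin (r + 1) → GenVilenkin.Digit Ds) (hξ : ∀ i, ξ i ≠ 0)
    (hw : GenVilenkin.DistinctWindows n ξ)
    (b : (Fin n → GenVilenkin.Digit Ds) → ℂ) (hb : GenVilenkin.IsAssociatedMask ξ b) :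
    GenVilenkin.IsWalshPolynomial D Ds n (GenVilenkin.mask b) ∧
    (∃! φ : GenVilenkin.L2 D, GenVilenkin.IsFourierL2 φ (GenVilenkin.maskProd b)) ∧
    ∀ φ : GenVilenkin.L2 D, GenVilenkin.IsFourierL2 φ (GenVilenkin.maskProd b) →
      GenVilenkin.IsOrthogonalRefinable φ ∧
      (∃ f ∈ GenVilenkin.TestFun D ((r : ℤ) - n + 2) ((n : ℤ) - 1),
        φ =ᵐ[GenVilenkin.haar D] f) ∧
      MeasureTheory.Integrable φ (GenVilenkin.haar D) ∧
      ∀ ω : GenVilenkin.Vilenkin Ds,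
        GenVilenkin.fourier Ds φ ω = GenVilenkin.maskProd b ω ∧
        GenVilenkin.fourier Ds φ ω = GenVilenkin.explicitFourier ξ b ω := by
  open GenVilenkin in
  -- Inversion takes a natural index, whereas the invariance of the mask product is stated with the
  -- integer $n-1$.
  have hcast : ((n - 1 : ℕ) : ℤ) = (n : ℤ) - 1 := by omega
  have hginv : ∀ ω, ∀ u ∈ U Ds ((n - 1 : ℕ) : ℤ), maskProd b (ω + u) = maskProd b ω := by
    intro ω u hu
    exact maskProd_add_of_mem_U b ω (by rwa [← hcast])
  have hgsupp := support_maskProd_subset hn hξ hw hb hr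
  have hg := integrable_of_invariant hginv hgsupp
  have hg2 := memLp_of_invariant hginv hgsupp
  have hfinv : ∀ x, ∀ u ∈ U D ((r : ℤ) - n + 2),
      invFourier D (maskProd b) (x + u) = invFourier D (maskProd b) x := fun x u hu =>
    invFourier_add_of_mem_U hgsupp x hu
  have hfsupp := support_invFourier_subset (D := D) hginv
  have hf := integrable_of_invariant hfinv hfsupp
  have hf2 := memLp_of_invariant hfinv hfsupp
  have hfourier : ∀ ω, fourier Ds (invFourier D (maskProd b)) ω = maskProd b ω :=
    fourier_invFourier hg hginv
  have hcongr : ∀ φ : L2 D, φ =ᵐ[haar D] invFourier D (maskProd b) →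
      ∀ ω, fourier Ds φ ω = maskProd b ω := by
    intro φ hφ ω
    rw [← hfourier ω]
    refine integral_congr_ae ?_
    filter_upwards [hφ] with x hx
    rw [hx]
  have hwalsh : IsWalshPolynomial D Ds n (mask b) := isWalshPolynomial_mask b
  have hex : IsFourierL2 (hf2.toLp _) (maskProd b) := by
    -- The function is already integrable, so a constant sequence serves as the approximation.
    refine ⟨hg2, fun _ => hf2.toLp _, fun _ => hf.congr hf2.coeFn_toLp.symm,
      tendsto_const_nhds, ?_⟩
    simp [hcongr _ hf2.coeFn_toLp]
  refine ⟨hwalsh, ⟨_, hex, fun ψ hψ => hψ.unique hex⟩, fun φ hφ => ?_⟩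
  have hφf : φ =ᵐ[haar D] invFourier D (maskProd b) := by
    rw [hφ.unique hex]; exact hf2.coeFn_toLp
  refine ⟨⟨?_, ?_⟩, ⟨_, mem_testFun hfinv (by rwa [hcast] at hfsupp), hφf⟩, hf.congr hφf.symm,
    fun ω => ⟨hcongr φ hφf ω, ?_⟩⟩
  · obtain ⟨α, hα⟩ := exists_refinement_coefficients hg hwalsh (maskProd_eq_mask_mul hb.zero)
    refine ⟨α, ?_⟩
    have hall := ae_all_iff.2 fun k : ℕ => ae_eq_comp_dil_add hφf 1 (gam D k)
    filter_upwards [hφf, hall] with x hx hxk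
    simp only [hx, hxk]
    exact hα x
  · refine orthonormal_translate hφf fun h hh h' hh' => ?_
    have hsub : h' - h ∈ H D := fun j hj => by rw [coe_sub, hh j hj, hh' j hj, sub_zero]
    rw [integral_conj_translate_mul_translate hg hf hfourier,
      integral_conj_maskProd_mul_self_mul_chi hn hr hξ hw hb hsub, setIntegral_chi_right, neg_zero]
    simp [Measure.real, haar_U]
  · rw [hcongr φ hφf ω, maskProd_eq_explicitFourier hn hr hξ hw hb ω]
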